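/- Let $N\ge 1$ be an integer and identify $\mathbb R^2$ with $\mathbb C$. **Definitions.** Let $\mathcal S=\bigcup_{i=1}^N\mathcal S_i\subset\mathbb R^2$. A *family of age $i$* ($1\le i\le N-1$) is a list $\mathcal F=(v_1,v_2;v_3,v_4)$ with $v_1,v_2\in\mathcal S_i$ (the parents, spouses of each other) and $v_3,v_4\in\mathcal S_{i+1}$ (the children, siblings of each other), the four points being distinct and satisfying $v_1+v_2=v_3+v_4$ and $|v_1|^2+|v_2|^2=|v_3|^2+|v_4|^2$ (so they are the vertices of a non-degenerate rectangle). The lists obtained by exchanging $v_1,v_2$ and/or $v_3,v_4$ are regarded as the same family. $\mathcal S$ is a *generation set* if (1) for $1\le i\le N-1$ every $v\in\mathcal S_i$ belongs to exactly one family of age $i$; (2) for $2\le i\le N$ every $v\in\mathcal S_i$ belongs to exactly one family of age $i-1$; (3) for $2\le i\le N-1$ the spouse of any $v\in\mathcal S_i$ is different from its sibling. For $\lambda\in\mathbb Z^{\mathcal S}$ put $|\lambda|=\sum_{v\in\mathcal S}|\lambda_v|$, and let $e_v$ denote the standard basis vectors. For a family put $\lambda^{\mathcal F}=e_{v_1}+e_{v_2}-e_{v_3}-e_{v_4}$.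 The vector $\lambda$ is *resonant* if $\sum_v\lambda_v=0$, $|\lambda|\le 6$, $\sum_v\lambda_v v=0$ and $\sum_v\lambda_v|v|^2=0$; a resonant vector is *of type CF* if it equals $\pm(\lambda^{\mathcal F_1}+\lambda^{\mathcal F_2})$ for two different families $\mathcal F_1\ne\mathcal F_2$. A generation set is *non-degenerate* if every $\lambda\in\mathbb Z^{\mathcal S}$ with $\sum_v\lambda_v=1$, $|\lambda|\le5$ and $\sum_v\lambda_v|v|^2-\big|\sum_v\lambda_v v\big|^2=0$ satisfies one of the following: (i) $|\lambda|=1$; (ii) $|\lambda|=3$, the support of $\lambda$ consists of three distinct members of one family, and the two members with positive coefficient are either its two parents or its two children; (iii) $|\lambda|=5$ and $\lambda=\pm\lambda^{\mathcal F}+e_v$ for some family $\mathcal F$ and some $v\in\mathcal S$; (iv) $|\lambda|=5$ and $\lambda-e_v$ is a resonant vector of type CF for some $v\in\mathcal S$. **The sets $\mathcal S(\mathcal S_1,\vartheta)$.** The members of each generation $k=1,\dots,N$ are labelled by $z\in\{0,1\}^{N-1}$. For $1\le k\le N-1$ there is one abstract family of age $k$ for each choice of the coordinates $z_l$, $l\ne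 k$: its parents are the two members of generation $k$, and its children the two members of generation $k+1$, having these coordinates (and $z_k\in\{0,1\}$). There are $(N-1)2^{N-2}$ abstract families. Let $$\mathcal X=\mathbb R^{2^N}\times\mathbb T^{(N-1)2^{N-2}},\qquad \mathbb T=\mathbb R/2\pi\mathbb Z .$$ A point of $\mathcal X$ consists of the positions of the $2^{N-1}$ members of the first generation and a procreation angle $\vartheta^{\mathcal F}$ for each abstract family. It determines the positions of all other members recursively: if the parents with $z_k=0$ and $z_k=1$ of an abstract family $\mathcal F$ of age $k$ are at $p$ and $q$, then its children with $z_k=0$ and $z_k=1$ are at $$\frac{p+q}2+e^{i\vartheta^{\mathcal F}}\frac{p-q}2\qquad\text{and}\qquad \frac{p+q}2-e^{i\vartheta^{\mathcal F}}\frac{p-q}2$$ respectively. Let $\mathcal S_i$ be the set of positions of the members of generation $i$, and $\mathcal S(\mathcal S_1,\vartheta)=\bigcup_i\mathcal S_i$. **Proposition.** There is a closed set $\mathcal D\subset\mathcal X$ of Lebesgue measure zero such that for every $(\mathcal S_1,\vartheta)\in\mathcal X\setminus\mathcal D$ the $N2^{N-1}$ positions are pairwise distinct and $\mathcal S(\mathcal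 S_1,\vartheta)$ is a non-degenerate generation set. In particular, every nonzero resonant vector for $\mathcal S(\mathcal S_1,\vartheta)$ is equal to $\pm\lambda^{\mathcal F}$ for some family $\mathcal F$ or is of type CF. -/

import Mathlib

noncomputable section

namespace GenSet

/-! ## Families, generation sets and non-degeneracy

The plane is `ℂ`. A configuration of `N` generations is a map `G : Fin N → Set ℂ`; the generations
and the ages of the families are numbered from `0`. -/

/-- A list `(p₁, p₂; c₁, c₂)` of four points of the plane. -/
structure Quad where
  p₁ : ℂ
  p₂ : ℂ
  c₁ : ℂ
  c₂ : ℂ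

namespace Quad

/-- The set of the four points of the list. -/
def points (F : Quad) : Set ℂ := {F.p₁, F.p₂, F.c₁, F.c₂}

/-- `F'` is one of the four trivial permutations of `F`. -/
def TrivialPerm (F F' : Quad) : Prop :=
  F' = ⟨F.p₁, F.p₂, F.c₁, F.c₂⟩ ∨ F' = ⟨F.p₂, F.p₁, F.c₁, F.c₂⟩ ∨
  F' = ⟨F.p₁, F.p₂, F.c₂, F.c₁⟩ ∨ F' = ⟨F.p₂, F.p₁, F.c₂, F.c₁⟩

/-- The integer vector of `F`, with formal sum `p₁ + p₂ - c₁ - c₂`. -/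
def vec (F : Quad) : ℂ →₀ ℤ :=
  Finsupp.single F.p₁ 1 + Finsupp.single F.p₂ 1 - Finsupp.single F.c₁ 1 - Finsupp.single F.c₂ 1

end Quad

variable {N : ℕ}

/-- `F` is a family of age `i`: its points are the vertices of a non-degenerate rectangle (four
distinct points), with the parents `p₁, p₂` (one diagonal) in generation `i` and the children
`c₁, c₂` (the other diagonal) in generation `i + 1`. -/
structure IsFamily (G : Fin N → Set ℂ) (i : ℕ) (F : Quad) : Prop where
  age_lt : i + 1 < N
  parent₁ : F.p₁ ∈ G ⟨i, Nat.lt_of_succ_lt age_lt⟩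
  parent₂ : F.p₂ ∈ G ⟨i, Nat.lt_of_succ_lt age_lt⟩
  child₁ : F.c₁ ∈ G ⟨i + 1, age_lt⟩
  child₂ : F.c₂ ∈ G ⟨i + 1, age_lt⟩
  sum_eq : F.p₁ + F.p₂ = F.c₁ + F.c₂
  sum_sq_eq : ‖F.p₁‖ ^ 2 + ‖F.p₂‖ ^ 2 = ‖F.c₁‖ ^ 2 + ‖F.c₂‖ ^ 2
  nondeg : [F.p₁, F.p₂, F.c₁, F.c₂].Nodup

/-- `v` and `w` are spouses: the two parents of some family. -/
def AreSpouses (G : Fin N → Set ℂ) (v w : ℂ) : Prop :=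
  ∃ i F, IsFamily G i F ∧ F.p₁ = v ∧ F.p₂ = w

/-- `v` and `w` are siblings: the two children of some family. -/
def AreSiblings (G : Fin N → Set ℂ) (v w : ℂ) : Prop :=
  ∃ i F, IsFamily G i F ∧ F.c₁ = v ∧ F.c₂ = w

/-- `v` is a member of one and only one family of age `i`, up to trivial permutations. -/
def UniqueFamily (G : Fin N → Set ℂ) (i : ℕ) (v : ℂ) : Prop :=
  ∃ F, IsFamily G i F ∧ v ∈ F.points ∧
    ∀ F', IsFamily G i F' → v ∈ F'.points → F.TrivialPerm F'

/-- Generation sets: every point outside the last generation is in exactly one family in which its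
generation is that of the parents, every point outside the first generation is in exactly one
family in which its generation is that of the children, and in the intermediate generations the
spouse of a point is never its sibling. -/
structure IsGenerationSet (G : Fin N → Set ℂ) : Prop where
  as_parent : ∀ i : Fin N, (i : ℕ) + 1 < N → ∀ v ∈ G i, UniqueFamily G i v
  as_child : ∀ i : Fin N, 0 < (i : ℕ) → ∀ v ∈ G i, UniqueFamily G ((i : ℕ) - 1) v
  spouse_ne_sibling : ∀ i : Fin N, 0 < (i : ℕ) → (i : ℕ) + 1 < N → ∀ v ∈ G i, ∀ w w',
    AreSpouses G v w → AreSiblings G v w' → w ≠ w'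

/-- The set `𝒮`, union of the generations. -/
def allPoints (G : Fin N → Set ℂ) : Set ℂ := ⋃ i, G i

/-! Integer vectors indexed by `𝒮` are finitely supported functions `ℂ →₀ ℤ` whose support is
contained in `𝒮`. -/

/-- `∑ λᵢ`. -/
def mass (l : ℂ →₀ ℤ) : ℤ := l.sum fun _ a => a

/-- `|λ| = ∑ |λᵢ|`. -/
def size (l : ℂ →₀ ℤ) : ℤ := l.sum fun _ a => |a|

/-- `∑ λᵢ vᵢ`. -/
def momentum (l : ℂ →₀ ℤ) : ℂ := l.sum fun v a => (a : ℂ) * v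

/-- `∑ λᵢ |vᵢ|²`. -/
def energy (l : ℂ →₀ ℤ) : ℝ := l.sum fun v a => (a : ℝ) * ‖v‖ ^ 2

/-- Resonant vectors for `𝒮`. -/
structure IsResonant (G : Fin N → Set ℂ) (l : ℂ →₀ ℤ) : Prop where
  support_subset : (l.support : Set ℂ) ⊆ allPoints G
  mass_eq : mass l = 0
  size_le : size l ≤ 6
  momentum_eq : momentum l = 0
  energy_eq : energy l = 0

/-- `l = ± λ^F` for some family `F`. -/
def IsFamilyVector (G : Fin N → Set ℂ) (l : ℂ →₀ ℤ) : Prop :=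
  ∃ i F, IsFamily G i F ∧ (l = F.vec ∨ l = -F.vec)

/-- Resonant vectors of type CF (couple of families): `± (λ^F₁ + λ^F₂)` with `F₁ ≠ F₂`, where
families that are trivial permutations of each other are the same. -/
def IsCF (G : Fin N → Set ℂ) (l : ℂ →₀ ℤ) : Prop :=
  IsResonant G l ∧ ∃ i j F₁ F₂, IsFamily G i F₁ ∧ IsFamily G j F₂ ∧ ¬ F₁.TrivialPerm F₂ ∧
    (l = F₁.vec + F₂.vec ∨ l = -(F₁.vec + F₂.vec))

/-- `|λ| = 3`, the support of `λ` consists of three distinct members of a family, and the two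
members with a positive coefficient are either the two parents or the two children. -/
def IsThreeOfFamily (G : Fin N → Set ℂ) (l : ℂ →₀ ℤ) : Prop :=
  size l = 3 ∧ ∃ i F, IsFamily G i F ∧ (l.support : Set ℂ) ⊆ F.points ∧ l.support.card = 3 ∧
    ({v | 0 < l v} = {F.p₁, F.p₂} ∨ {v | 0 < l v} = {F.c₁, F.c₂})

/-- Non-degeneracy of a generation set. -/
def IsNonDegenerate (G : Fin N → Set ℂ) : Prop :=
  ∀ l : ℂ →₀ ℤ, (l.support : Set ℂ) ⊆ allPoints G → mass l = 1 → size l ≤ 5 →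
    energy l - ‖momentum l‖ ^ 2 = 0 →
      size l = 1 ∨
      IsThreeOfFamily G l ∨
      (size l = 5 ∧ ∃ m, IsFamilyVector G m ∧ ∃ v ∈ allPoints G, l = m + Finsupp.single v 1) ∨
      (size l = 5 ∧ ∃ v ∈ allPoints G, IsCF G (l - Finsupp.single v 1))

/-! ## The genealogical tree and the placement

In the abstract combinatorial model each generation is a copy of the cube `{false, true}^(N-1)`.
A family of age `k` is an edge of the cube in direction `k`: its parents are the two endpoints of
this edge in generation `k`, its children are the two endpoints in generation `k + 1`. -/

/-- The members of a generation, in the abstract model. -/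
abbrev Label (N : ℕ) : Type := Fin (N - 1) → Bool

/-- The families of the abstract model: an age `k` and the labels in the directions other than
`k`. -/
abbrev FamilyIndex (N : ℕ) : Type := (k : Fin (N - 1)) × ({l : Fin (N - 1) // l ≠ k} → Bool)

theorem card_label (N : ℕ) : Fintype.card (Label N) = 2 ^ (N - 1) := by simp

theorem card_familyIndex (N : ℕ) :
    Fintype.card (FamilyIndex N) = (N - 1) * 2 ^ (N - 2) := by
  simp [Fintype.card_subtype_compl, Nat.sub_sub]

instance two_pi_pos : Fact (0 < 2 * Real.pi) := ⟨Real.two_pi_pos⟩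

/-- The parameter space `𝒳 = ℝ^(2^N) × 𝕋^((N-1) 2^(N-2))`: a point of the plane for each of the
`2^(N-1)` members of the first generation and an angle modulo `2π` for each family. Its measure
`volume` is the product of the Lebesgue measures. -/
abbrev Params (N : ℕ) : Type :=
  (Label N → ℂ) × (FamilyIndex N → AddCircle (2 * Real.pi))

/-- The family of age `k` one of whose edge endpoints is labelled by `z`. -/
def familyOf (k : Fin (N - 1)) (z : Label N) : FamilyIndex N := ⟨k, fun l => z l⟩

/-- The placement of generation `k` in the plane. The first generation is placed freely. If a
family has its parents at `p` and `q` and its procreation angle is `ϑ`, then its children are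
at `(p + q) / 2 ± e^{iϑ} (p - q) / 2`: the diameter joining the children is the diameter joining
the parents, rotated by `ϑ`. -/
def place (x : Params N) : (k : ℕ) → k < N → Label N → ℂ
  | 0, _, z => x.1 z
  | k + 1, h, z =>
    let j : Fin (N - 1) := ⟨k, Nat.lt_sub_of_add_lt h⟩
    let p := place x k (Nat.lt_of_succ_lt h) (Function.update z j false)
    let q := place x k (Nat.lt_of_succ_lt h) (Function.update z j true)
    let e : ℂ := AddCircle.toCircle (x.2 (familyOf j z))
    if z j then (p + q) / 2 - e * ((p - q) / 2) else (p + q) / 2 + e * ((p - q) / 2)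

/-- The position of the member of generation `a.1` labelled by `a.2`. -/
def position (x : Params N) (a : Fin N × Label N) : ℂ := place x a.1 a.1.isLt a.2

/-- The generations of the set `𝒮(𝒮₁, ϑ)` determined by the parameters `x`. -/
def generations (x : Params N) (i : Fin N) : Set ℂ :=
  Set.range fun z : Label N => position x (i, z)

end GenSet

end

/-!
Call `∑ λᵥ |v|² - |∑ λᵥ v|²` the defect of `λ`. It is a real analytic function on `𝒳`, so its zero
set is closed, and null unless the defect vanishes identically; `D` is the union of these zero sets
over the finitely many `λ` of mass one and size at most five whose defect is not identically zero.

Suppose that the defect of `λ`, of mass one, vanishes identically, and let `F` be a family whose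
children belong to the last generation that meets the support of `λ`. The defect is a trigonometric
polynomial in the angle of `F`. Hence either the two children of `F` have the same coefficient in
`λ`, or the momentum `∑ λᵥ v` is, for all parameters, the position of a child of `F`. In the first
case for all `F`, subtracting multiples of the `λ^F` moves `λ` up by one generation. So the momentum
is always the position of some member `u`, and then momentum and energy of `λ - e_u` vanish
identically. The same descent now meets only the first case and gives `λ = e_u + ∑ n_F λ^F`.

It remains to find the combinations `∑ n_F λ^F` of size at most six. The labels are the vertices of
a cube, and a family is an edge together with its age, which is the direction of the edge. Over a
label `z` the coefficients are the increments of the sequence of the `n_F` with `z ∈ F`, which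
begins and ends at `0`. The size is therefore the sum over `z` of the total variations of these
sequences, each at least two if `z` is an endpoint of a family with `n_F ≠ 0`. At most three
vertices are thus covered, and three vertices of a cube span at most two edges.
-/

noncomputable section

namespace GenSet

/-! ### Analytic functions on the product of a vector space and a torus -/

section AnalyticZeros

open MeasureTheory

theorem volume_zeros_of_analytic_real {F : Type*} [NormedAddCommGroup F] [NormedSpace ℝ F]
    {g : ℝ → F} (hg : AnalyticOnNhd ℝ g Set.univ) {t₀ : ℝ} (h₀ : g t₀ ≠ 0) :
    volume {t | g t = 0} = 0 := by
  have hcod := (hg.eqOn_zero_or_eventually_ne_zero_of_preconnected isPreconnected_univ).resolve_left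
    fun h => h₀ (h (Set.mem_univ t₀))
  have hae := ae_restrict_le_codiscreteWithin (μ := (volume : Measure ℝ)) MeasurableSet.univ hcod
  rw [Measure.restrict_univ] at hae
  exact measure_eq_zero_iff_ae_notMem.2 hae

theorem measure_zeros_of_analytic {E F : Type*} [NormedAddCommGroup E] [NormedSpace ℝ E]
    [FiniteDimensional ℝ E] [MeasurableSpace E] [BorelSpace E] (μ : Measure E) [μ.IsAddHaarMeasure]
    [NormedAddCommGroup F] [NormedSpace ℝ F] {f : E → F}
    (hf : AnalyticOnNhd ℝ f Set.univ) {x₀ : E} (h₀ : f x₀ ≠ 0) : μ {x | f x = 0} = 0 := by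
  have hcont : Continuous fun p : ℝ × E => f (AffineMap.homothety x₀ p.1 p.2) := by
    have hf' : Continuous f := continuousOn_univ.1 hf.continuousOn
    simp only [AffineMap.homothety_apply, vsub_eq_sub, vadd_eq_add]
    fun_prop
  have hline (x : E) : ∀ᵐ t : ℝ, f (AffineMap.homothety x₀ t x) ≠ 0 := by
    refine measure_eq_zero_iff_ae_notMem.1 (volume_zeros_of_analytic_real (t₀ := 0) ?_ ?_)
    · simp only [AffineMap.homothety_apply, vsub_eq_sub, vadd_eq_add]
      exact fun t _ => (hf _ (Set.mem_univ _)).fun_comp (by fun_prop)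
    · rwa [AffineMap.homothety_zero, AffineMap.const_apply]
  -- Almost every homothety with center `x₀` pulls the zero set of `f` back to a null set.
  have hfubini : ∀ᵐ t : ℝ, ∀ᵐ x ∂μ, f (AffineMap.homothety x₀ t x) ≠ 0 :=
    Measure.ae_ae_comm (isClosed_singleton.preimage hcont).measurableSet.compl |>.2
      (.of_forall hline)
  obtain ⟨t, ht, ht0⟩ := (hfubini.and (Measure.ae_ne volume (0 : ℝ))).exists
  have himage : AffineMap.homothety x₀ t '' {x | f (AffineMap.homothety x₀ t x) = 0} =
      {x | f x = 0} :=
    Set.image_preimage_eq {x | f x = 0}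
      (AffineEquiv.homothetyUnitsMulHom x₀ (Units.mk0 t ht0)).surjective
  have hnull : μ {x | f (AffineMap.homothety x₀ t x) = 0} = 0 :=
    measure_eq_zero_iff_ae_notMem.2 ht
  rw [← himage, Measure.addHaar_image_homothety, hnull, mul_zero]

variable {V ι : Type*} {T : ℝ}

/-- The universal covering of the product of the vector space `V` and a torus. -/
def torusCover (x : V × (ι → ℝ)) : V × (ι → AddCircle T) := (x.1, fun i => x.2 i)

theorem isOpenQuotientMap_torusCover [TopologicalSpace V] :
    IsOpenQuotientMap (torusCover : V × (ι → ℝ) → V × (ι → AddCircle T)) :=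
  IsOpenQuotientMap.id.prodMap
    (IsOpenQuotientMap.piMap fun _ => QuotientAddGroup.isOpenQuotientMap_mk)

variable [NormedAddCommGroup V] [NormedSpace ℝ V] [Fintype ι]

/-- Real analytic functions on the product of a vector space and a torus: the functions whose lifts
to the universal covering are analytic. -/
def LiftAnalytic {F : Type*} [NormedAddCommGroup F] [NormedSpace ℝ F]
    (f : V × (ι → AddCircle T) → F) : Prop :=
  AnalyticOnNhd ℝ (f ∘ torusCover) Set.univ

namespace LiftAnalytic

section Module

variable {F : Type*} [NormedAddCommGroup F] [NormedSpace ℝ F] {f g : V × (ι → AddCircle T) → F}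

theorem continuous (hf : LiftAnalytic f) : Continuous f :=
  isOpenQuotientMap_torusCover.continuous_comp_iff.1 (continuousOn_univ.1 hf.continuousOn)

theorem const (c : F) : LiftAnalytic fun _ : V × (ι → AddCircle T) => c := analyticOnNhd_const

theorem clm (L : V →L[ℝ] F) : LiftAnalytic fun x : V × (ι → AddCircle T) => L x.1 :=
  (L.comp (.fst ℝ V (ι → ℝ))).analyticOnNhd _

theorem add (hf : LiftAnalytic f) (hg : LiftAnalytic g) : LiftAnalytic fun x => f x + g x :=
  AnalyticOnNhd.add hf hg

theorem sub (hf : LiftAnalytic f) (hg : LiftAnalytic g) : LiftAnalytic fun x => f x - g x :=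
  AnalyticOnNhd.sub hf hg

theorem sum {κ : Type*} (s : Finset κ) {f : κ → V × (ι → AddCircle T) → F}
    (hf : ∀ i, LiftAnalytic (f i)) : LiftAnalytic fun x => ∑ i ∈ s, f i x :=
  Finset.analyticOnNhd_fun_sum _ fun i _ => hf i

theorem clm_comp {G : Type*} [NormedAddCommGroup G] [NormedSpace ℝ G] (L : F →L[ℝ] G)
    (hf : LiftAnalytic f) : LiftAnalytic fun x => L (f x) :=
  L.comp_analyticOnNhd hf

variable [FiniteDimensional ℝ V] [MeasureSpace V] [BorelSpace V]
  [(volume : Measure V).IsAddHaarMeasure] [Fact (0 < T)]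

theorem volume_zeros (hf : LiftAnalytic f) {x₀ : V × (ι → AddCircle T)} (h₀ : f x₀ ≠ 0) :
    volume {x | f x = 0} = 0 := by
  have hcover : MeasurePreserving (torusCover : V × (ι → ℝ) → V × (ι → AddCircle T))
      (volume.prod (volume.restrict (Set.univ.pi fun _ => Set.Ioc 0 (0 + T)))) := by
    rw [volume_pi, Measure.restrict_pi_pi]
    exact (MeasurePreserving.id _).prod
      (measurePreserving_pi _ _ fun _ => AddCircle.measurePreserving_mk T 0)
  obtain ⟨y₀, rfl⟩ := isOpenQuotientMap_torusCover.surjective x₀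
  have hclosed : IsClosed {x | f x = 0} := isClosed_singleton.preimage hf.continuous
  rw [← hcover.measure_preimage hclosed.measurableSet.nullMeasurableSet]
  have hle : (volume : Measure V).prod
      ((volume : Measure (ι → ℝ)).restrict (Set.univ.pi fun _ => Set.Ioc 0 (0 + T))) ≤
      volume.prod volume := Measure.prod_mono le_rfl Measure.restrict_le_self
  exact hle.absolutelyContinuous (measure_zeros_of_analytic (volume.prod volume) hf h₀)

end Module

section Algebra

variable {A : Type*} [NormedRing A] [NormedAlgebra ℝ A] {f g : V × (ι → AddCircle T) → A}

theorem mul (hf : LiftAnalytic f) (hg : LiftAnalytic g) : LiftAnalytic fun x => f x * g x :=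
  AnalyticOnNhd.mul hf hg

theorem eq_zero_or_eq_zero_of_mul_eq_zero [NoZeroDivisors A] (hf : LiftAnalytic f)
    (hg : LiftAnalytic g) (h : ∀ x, f x * g x = 0) : (∀ x, f x = 0) ∨ ∀ x, g x = 0 := by
  refine or_iff_not_imp_left.2 fun hne => ?_
  push Not at hne
  obtain ⟨x₀, hx₀⟩ := hne
  obtain ⟨y₀, rfl⟩ := isOpenQuotientMap_torusCover.surjective x₀
  have hf_ne : ∀ᶠ y in nhds y₀, f (torusCover y) ≠ 0 :=
    (hf y₀ (Set.mem_univ _)).continuousAt.eventually_ne hx₀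
  have hg_zero : g ∘ torusCover = 0 := AnalyticOnNhd.eq_of_eventuallyEq hg analyticOnNhd_const <|
    hf_ne.mono fun y hy => (mul_eq_zero.1 (h (torusCover y))).resolve_left hy
  exact isOpenQuotientMap_torusCover.surjective.forall.2 (congrFun hg_zero)

end Algebra

theorem toCircle (i : ι) :
    LiftAnalytic fun x : V × (ι → AddCircle (2 * Real.pi)) => (AddCircle.toCircle (x.2 i) : ℂ) := by
  let θ : V × (ι → ℝ) →L[ℝ] ℂ := Complex.ofRealCLM ∘L .proj i ∘L .snd ℝ V (ι → ℝ)
  have hexp : ((fun x : V × (ι → AddCircle (2 * Real.pi)) => (AddCircle.toCircle (x.2 i) : ℂ)) ∘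
      torusCover) = fun x => Complex.exp (θ x * Complex.I) := by
    funext x
    simp only [torusCover, Function.comp_apply, AddCircle.toCircle_apply_mk, Circle.coe_exp,
      div_self Real.two_pi_pos.ne', one_mul]
    rfl
  rw [LiftAnalytic, hexp]
  exact fun x _ => analyticAt_cexp.restrictScalars.fun_comp ((θ.analyticAt x).mul analyticAt_const)

end LiftAnalytic

end AnalyticZeros

theorem liftAnalytic_place {N : ℕ} :
    ∀ (k : ℕ) (h : k < N) (z : Label N), LiftAnalytic fun x => place x k h z
  | 0, _, z => LiftAnalytic.clm (ContinuousLinearMap.proj (R := ℝ) (φ := fun _ => ℂ) z)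
  | k + 1, h, z => by
    have ih := liftAnalytic_place k (Nat.lt_of_succ_lt h)
    simp only [place, div_eq_mul_inv]
    split_ifs
    · exact (((ih _).add (ih _)).mul (.const _)).sub
        ((LiftAnalytic.toCircle _).mul (((ih _).sub (ih _)).mul (.const _)))
    · exact (((ih _).add (ih _)).mul (.const _)).add
        ((LiftAnalytic.toCircle _).mul (((ih _).sub (ih _)).mul (.const _)))

theorem liftAnalytic_position {N : ℕ} (a : Fin N × Label N) :
    LiftAnalytic fun x => position x a :=
  liftAnalytic_place _ _ _

/-! ### Combinations of families -/

variable {N : ℕ}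

/-- The members of all generations, in the abstract model. -/
abbrev Member (N : ℕ) : Type := Fin N × Label N

namespace FamilyIndex

/-- The generation of the parents. -/
def parentGen (F : FamilyIndex N) : Fin N := ⟨F.1, by omega⟩

/-- The generation of the children. -/
def childGen (F : FamilyIndex N) : Fin N := ⟨F.1 + 1, by omega⟩

/-- The labels of the two parents, which are also those of the two children: the endpoints of the
edge `F` of the cube. -/
def endpoint (F : FamilyIndex N) (b : Bool) : Label N :=
  fun l => if h : l = F.1 then b else F.2 ⟨l, h⟩

/-- The parent with coordinate `b` in the direction of the family. -/
def parent (F : FamilyIndex N) (b : Bool) : Member N := (F.parentGen, F.endpoint b)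

/-- The child with coordinate `b` in the direction of the family. -/
def child (F : FamilyIndex N) (b : Bool) : Member N := (F.childGen, F.endpoint b)

/-- The set of the labels of the members of a family. -/
def ends (F : FamilyIndex N) : Finset (Label N) := {F.endpoint false, F.endpoint true}

@[simp]
theorem endpoint_self (F : FamilyIndex N) (b : Bool) : F.endpoint b F.1 = b := by
  simp [endpoint]

theorem endpoint_injective (F : FamilyIndex N) : Function.Injective F.endpoint := fun b b' h => by
  simpa using congrFun h F.1

@[simp]
theorem familyOf_endpoint (F : FamilyIndex N) (b : Bool) : familyOf F.1 (F.endpoint b) = F := by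
  obtain ⟨k, g⟩ := F
  simp only [familyOf, endpoint]
  congr 1
  funext l
  simp [l.2]

theorem endpoint_familyOf (k : Fin (N - 1)) (z : Label N) (b : Bool) :
    FamilyIndex.endpoint (familyOf k z) b = Function.update z k b := by
  funext l
  by_cases h : l = k
  · subst h; simp [endpoint, familyOf]
  · simp [endpoint, familyOf, h]

theorem update_endpoint (F : FamilyIndex N) (b b' : Bool) :
    Function.update (F.endpoint b) F.1 b' = F.endpoint b' := by
  rw [← endpoint_familyOf, familyOf_endpoint]

theorem endpoint_mem_ends (F : FamilyIndex N) (b : Bool) : F.endpoint b ∈ F.ends := by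
  cases b <;> simp [ends]

theorem card_ends (F : FamilyIndex N) : F.ends.card = 2 :=
  Finset.card_pair (F.endpoint_injective.ne Bool.false_ne_true)

theorem exists_eq_endpoint (k : Fin (N - 1)) (z : Label N) :
    ∃ b, z = FamilyIndex.endpoint (familyOf k z) b :=
  ⟨z k, by rw [endpoint_familyOf, Function.update_eq_self]⟩

theorem mem_ends {F : FamilyIndex N} {z : Label N} : z ∈ F.ends ↔ ∃ b, z = F.endpoint b := by
  simp [ends]

theorem mem_ends_iff_familyOf {F : FamilyIndex N} {z : Label N} :
    z ∈ F.ends ↔ familyOf F.1 z = F := by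
  refine ⟨fun h => ?_, fun h => ?_⟩
  · obtain ⟨b, rfl⟩ := mem_ends.1 h
    exact F.familyOf_endpoint b
  · have := exists_eq_endpoint F.1 z
    rwa [h, ← mem_ends] at this

theorem eq_of_mem_ends {F F' : FamilyIndex N} {z : Label N} (hage : F.1 = F'.1) (h : z ∈ F.ends)
    (h' : z ∈ F'.ends) : F = F' := by
  rw [mem_ends_iff_familyOf] at h h'
  rw [← h, ← h', hage]

theorem exists_eq_parent {a : Member N} (h : (a.1 : ℕ) + 1 < N) :
    ∃ (F : FamilyIndex N) (b : Bool), a = F.parent b := by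
  obtain ⟨b, hb⟩ := exists_eq_endpoint ⟨a.1, Nat.lt_sub_of_add_lt h⟩ a.2
  exact ⟨_, b, Prod.ext rfl hb⟩

theorem exists_eq_child {a : Member N} (h : 0 < (a.1 : ℕ)) :
    ∃ (F : FamilyIndex N) (b : Bool), a = F.child b := by
  obtain ⟨b, hb⟩ := exists_eq_endpoint ⟨a.1 - 1, by omega⟩ a.2
  refine ⟨_, b, Prod.ext (Fin.ext ?_) hb⟩
  exact (Nat.sub_add_cancel h).symm

theorem eq_of_endpoint_eq {F F' : FamilyIndex N} {b b' : Bool} (hage : F.1 = F'.1)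
    (h : F.endpoint b = F'.endpoint b') : F = F' ∧ b = b' := by
  obtain rfl := eq_of_mem_ends hage (F.endpoint_mem_ends b) (h ▸ F'.endpoint_mem_ends b')
  exact ⟨rfl, F.endpoint_injective h⟩

theorem parent_inj {F F' : FamilyIndex N} {b b' : Bool} :
    F.parent b = F'.parent b' ↔ F = F' ∧ b = b' := by
  refine ⟨fun h => ?_, by rintro ⟨rfl, rfl⟩; rfl⟩
  have hage : (F.1 : ℕ) = F'.1 := congrArg (fun a : Member N => (a.1 : ℕ)) h
  exact eq_of_endpoint_eq (Fin.ext hage) (congrArg Prod.snd h)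

theorem child_inj {F F' : FamilyIndex N} {b b' : Bool} :
    F.child b = F'.child b' ↔ F = F' ∧ b = b' := by
  refine ⟨fun h => ?_, by rintro ⟨rfl, rfl⟩; rfl⟩
  have hage : (F.1 : ℕ) + 1 = F'.1 + 1 := congrArg (fun a : Member N => (a.1 : ℕ)) h
  exact eq_of_endpoint_eq (Fin.ext (Nat.succ_injective hage)) (congrArg Prod.snd h)

theorem parent_ne (F : FamilyIndex N) : F.parent false ≠ F.parent true :=
  parent_inj.not.2 fun h => Bool.false_ne_true h.2

theorem child_ne (F : FamilyIndex N) : F.child false ≠ F.child true :=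
  child_inj.not.2 fun h => Bool.false_ne_true h.2

theorem parent_ne_child (F : FamilyIndex N) (b b' : Bool) : F.parent b ≠ F.child b' := fun h =>
  (Nat.lt_succ_self (F.1 : ℕ)).ne (congrArg (fun a : Member N => (a.1 : ℕ)) h)

/-- The integer vector of an abstract family. -/
def vec (F : FamilyIndex N) : Member N → ℤ :=
  Pi.single (F.parent false) 1 + Pi.single (F.parent true) 1 -
    Pi.single (F.child false) 1 - Pi.single (F.child true) 1

theorem vec_apply (F : FamilyIndex N) (a : Member N) :
    F.vec a = (if F.1 + 1 = (a.1 : ℕ) + 1 ∧ a.2 ∈ F.ends then 1 else 0) -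
      (if F.1 + 1 = (a.1 : ℕ) ∧ a.2 ∈ F.ends then 1 else 0) := by
  obtain ⟨k, z⟩ := a
  have hne : F.endpoint false ≠ F.endpoint true := F.endpoint_injective.ne Bool.false_ne_true
  simp only [ends, Finset.mem_insert, Finset.mem_singleton, vec, Pi.add_apply, Pi.sub_apply,
    Pi.single_apply, parent, child, Prod.mk.injEq, parentGen, childGen, Fin.ext_iff]
  grind

theorem vec_eq_one_iff {F : FamilyIndex N} {a : Member N} :
    F.vec a = 1 ↔ ∃ b, a = F.parent b := by
  have hparent : (∃ b, a = F.parent b) ↔ F.1 + 1 = (a.1 : ℕ) + 1 ∧ a.2 ∈ F.ends := by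
    simp only [mem_ends, parent, parentGen, Prod.ext_iff, Fin.ext_iff]
    grind
  rw [vec_apply, hparent]
  grind

theorem vec_eq_neg_one_iff {F : FamilyIndex N} {a : Member N} :
    F.vec a = -1 ↔ ∃ b, a = F.child b := by
  have hchild : (∃ b, a = F.child b) ↔ F.1 + 1 = (a.1 : ℕ) ∧ a.2 ∈ F.ends := by
    simp only [mem_ends, child, childGen, Prod.ext_iff, Fin.ext_iff]
    grind
  rw [vec_apply, hchild]
  grind

end FamilyIndex

/-- The combination of the vectors of the families with coefficients `n`. -/
def familySum (n : FamilyIndex N → ℤ) : Member N → ℤ := ∑ F, n F • F.vec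

/-- The coefficient of the family of age `j - 1` one of whose members is labelled by `z`, and `0`
if there is no such family. With this shift the coefficient of a member in a combination of families
is the increment of the height at its generation. -/
def height (n : FamilyIndex N → ℤ) (z : Label N) (j : ℕ) : ℤ :=
  ∑ F : FamilyIndex N, if F.1 + 1 = j ∧ z ∈ F.ends then n F else 0

theorem familySum_apply (n : FamilyIndex N → ℤ) (a : Member N) :
    familySum n a = height n a.2 (a.1 + 1) - height n a.2 a.1 := by
  simp only [familySum, height, Finset.sum_apply, Pi.smul_apply, FamilyIndex.vec_apply,
    smul_eq_mul, mul_sub, Finset.sum_sub_distrib, mul_ite, mul_one, mul_zero]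

theorem height_of_mem_ends (n : FamilyIndex N → ℤ) {F : FamilyIndex N} {z : Label N}
    (hz : z ∈ F.ends) : height n z (F.1 + 1) = n F := by
  rw [height, Finset.sum_eq_single F]
  · exact if_pos ⟨rfl, hz⟩
  · intro F' _ hne
    exact if_neg fun h => hne (FamilyIndex.eq_of_mem_ends (by grind) h.2 hz)
  · exact fun h => absurd (Finset.mem_univ F) h

theorem height_eq_zero {n : FamilyIndex N → ℤ} {z : Label N} {j : ℕ}
    (h : ∀ F : FamilyIndex N, F.1 + 1 = j → z ∈ F.ends → n F = 0) : height n z j = 0 :=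
  Finset.sum_eq_zero fun F _ => by
    split_ifs with hF
    exacts [h F hF.1 hF.2, rfl]

theorem familySum_zero : familySum (0 : FamilyIndex N → ℤ) = 0 := by
  simp [familySum]

theorem familySum_add (n m : FamilyIndex N → ℤ) :
    familySum (n + m) = familySum n + familySum m := by
  simp [familySum, add_smul, Finset.sum_add_distrib]

theorem familySum_neg (n : FamilyIndex N → ℤ) : familySum (-n) = -familySum n := by
  simp [familySum]

theorem familySum_single (F : FamilyIndex N) : familySum (Pi.single F 1) = F.vec := by
  simp [familySum, Pi.single_apply]

/-! ### Identically vanishing defects -/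

open scoped ComplexConjugate

/-- `∑ λᵥ v`, where the members are at the positions given by the parameters `x`. -/
def momentumAt (x : Params N) : (Member N → ℤ) →ₗ[ℤ] ℂ :=
  Fintype.linearCombination ℤ (position x)

/-- `∑ λᵥ |v|²`, where the members are at the positions given by the parameters `x`. It is
complex valued so that it can be combined with momenta. -/
def energyAt (x : Params N) : (Member N → ℤ) →ₗ[ℤ] ℂ :=
  Fintype.linearCombination ℤ fun a => position x a * conj (position x a)

/-- `∑ λᵥ |v|² - |∑ λᵥ v|²`, where the members are at the positions given by the parameters `x`. -/
def defect (x : Params N) (l : Member N → ℤ) : ℂ :=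
  energyAt x l - momentumAt x l * conj (momentumAt x l)

@[simp]
theorem momentumAt_single (x : Params N) (a : Member N) (c : ℤ) :
    momentumAt x (Pi.single a c) = c * position x a := by
  rw [momentumAt, Fintype.linearCombination_apply_single, zsmul_eq_mul]

@[simp]
theorem energyAt_single (x : Params N) (a : Member N) (c : ℤ) :
    energyAt x (Pi.single a c) = c * (position x a * conj (position x a)) := by
  rw [energyAt, Fintype.linearCombination_apply_single, zsmul_eq_mul]

theorem liftAnalytic_conj_position (a : Member N) :
    LiftAnalytic fun x => conj (position x a) :=
  (liftAnalytic_position a).clm_comp Complex.conjCLE.toContinuousLinearMap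

theorem liftAnalytic_momentumAt (l : Member N → ℤ) : LiftAnalytic fun x => momentumAt x l := by
  simp only [momentumAt, Fintype.linearCombination_apply, zsmul_eq_mul]
  exact .sum _ fun a => (LiftAnalytic.const _).mul (liftAnalytic_position a)

theorem liftAnalytic_energyAt (l : Member N → ℤ) : LiftAnalytic fun x => energyAt x l := by
  simp only [energyAt, Fintype.linearCombination_apply, zsmul_eq_mul]
  exact .sum _ fun a => (LiftAnalytic.const _).mul
    ((liftAnalytic_position a).mul (liftAnalytic_conj_position a))

theorem liftAnalytic_defect (l : Member N → ℤ) : LiftAnalytic fun x => defect x l :=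
  (liftAnalytic_energyAt l).sub <| (liftAnalytic_momentumAt l).mul <|
    (liftAnalytic_momentumAt l).clm_comp Complex.conjCLE.toContinuousLinearMap

/-- The sign `1` of `false` and `-1` of `true`. -/
def sgn (b : Bool) : ℂ := if b then -1 else 1

/-- The center of the rectangle formed by a family. -/
def center (x : Params N) (F : FamilyIndex N) : ℂ :=
  (position x (F.parent false) + position x (F.parent true)) / 2

/-- Half of the diameter joining the parents of a family. -/
def halfDiameter (x : Params N) (F : FamilyIndex N) : ℂ :=
  (position x (F.parent false) - position x (F.parent true)) / 2

/-- The rotation that takes the parents of a family to the children. -/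
def rotation (x : Params N) (F : FamilyIndex N) : ℂ := AddCircle.toCircle (x.2 F)

theorem liftAnalytic_center (F : FamilyIndex N) : LiftAnalytic fun x => center x F := by
  simp only [center, div_eq_mul_inv]
  exact ((liftAnalytic_position _).add (liftAnalytic_position _)).mul (.const _)

theorem liftAnalytic_halfDiameter (F : FamilyIndex N) :
    LiftAnalytic fun x => halfDiameter x F := by
  simp only [halfDiameter, div_eq_mul_inv]
  exact ((liftAnalytic_position _).sub (liftAnalytic_position _)).mul (.const _)

theorem coe_mul_conj_coe (u : Circle) : (u : ℂ) * conj (u : ℂ) = 1 := by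
  rw [Complex.mul_conj, Circle.normSq_coe, Complex.ofReal_one]

theorem rotation_mul_conj (x : Params N) (F : FamilyIndex N) :
    rotation x F * conj (rotation x F) = 1 :=
  coe_mul_conj_coe _

theorem position_parent (x : Params N) (F : FamilyIndex N) (b : Bool) :
    position x (F.parent b) = center x F + sgn b * halfDiameter x F := by
  cases b <;> simp only [center, halfDiameter, sgn, Bool.false_eq_true, if_false, if_true] <;> ring

theorem position_child (x : Params N) (F : FamilyIndex N) (b : Bool) :
    position x (F.child b) = center x F + sgn b * (rotation x F * halfDiameter x F) := by
  have hF := F.familyOf_endpoint b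
  have hparents := F.update_endpoint b
  have hb := F.endpoint_self b
  simp only [position, FamilyIndex.child, FamilyIndex.childGen, place, FamilyIndex.parent,
    FamilyIndex.parentGen, Fin.eta, hF, hparents, hb, center, halfDiameter, rotation, sgn]
  split_ifs <;> ring

theorem momentumAt_vec (x : Params N) (F : FamilyIndex N) : momentumAt x F.vec = 0 := by
  simp only [FamilyIndex.vec, map_add, map_sub, momentumAt_single, position_child, position_parent,
    sgn, Bool.false_eq_true, if_false, if_true]
  push_cast
  ring

theorem energyAt_vec (x : Params N) (F : FamilyIndex N) : energyAt x F.vec = 0 := by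
  simp only [FamilyIndex.vec, map_add, map_sub, map_mul, map_neg, map_one, energyAt_single,
    position_child, position_parent, sgn, Bool.false_eq_true, if_false, if_true]
  push_cast
  linear_combination
    (-2) * (halfDiameter x F * conj (halfDiameter x F)) * rotation_mul_conj x F

theorem momentumAt_familySum (x : Params N) (n : FamilyIndex N → ℤ) :
    momentumAt x (familySum n) = 0 := by
  simp only [familySum, map_sum, map_zsmul, momentumAt_vec, smul_zero, Finset.sum_const_zero]

theorem energyAt_familySum (x : Params N) (n : FamilyIndex N → ℤ) :
    energyAt x (familySum n) = 0 := by
  simp only [familySum, map_sum, map_zsmul, energyAt_vec, smul_zero, Finset.sum_const_zero]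

theorem defect_sub_familySum (x : Params N) (l : Member N → ℤ) (n : FamilyIndex N → ℤ) :
    defect x (l - familySum n) = defect x l := by
  simp only [defect, map_sub, momentumAt_familySum, energyAt_familySum, sub_zero]

theorem sum_familySum (n : FamilyIndex N → ℤ) : ∑ a, familySum n a = 0 := by
  have hvec (F : FamilyIndex N) : ∑ a, F.vec a = 0 := by
    simp [FamilyIndex.vec, Finset.sum_add_distrib, Finset.sum_sub_distrib]
  simp only [familySum, Finset.sum_apply, Pi.smul_apply, smul_eq_mul]
  rw [Finset.sum_comm]
  simp only [← Finset.mul_sum, hvec, mul_zero, Finset.sum_const_zero]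

/-- The parameters with the angle of one family changed. -/
def setAngle (x : Params N) (F : FamilyIndex N) (t : AddCircle (2 * Real.pi)) : Params N :=
  (x.1, Function.update x.2 F t)

theorem place_setAngle_of_le (x : Params N) (F : FamilyIndex N) (t : AddCircle (2 * Real.pi)) :
    ∀ (k : ℕ) (h : k < N) (z : Label N), k ≤ F.1 → place (setAngle x F t) k h z = place x k h z
  | 0, _, _, _ => rfl
  | k + 1, h, z, hk => by
    have ih := fun z => place_setAngle_of_le x F t k (Nat.lt_of_succ_lt h) z (by omega)
    have hF : familyOf ⟨k, Nat.lt_sub_of_add_lt h⟩ z ≠ F := by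
      rintro rfl
      exact absurd hk (Nat.not_succ_le_self k)
    have hangle : (setAngle x F t).2 (familyOf ⟨k, Nat.lt_sub_of_add_lt h⟩ z) =
        x.2 (familyOf ⟨k, Nat.lt_sub_of_add_lt h⟩ z) := Function.update_of_ne hF _ _
    simp only [place, ih, hangle]

theorem position_parent_setAngle (x : Params N) (F : FamilyIndex N) (t : AddCircle (2 * Real.pi))
    (b : Bool) : position (setAngle x F t) (F.parent b) = position x (F.parent b) :=
  place_setAngle_of_le x F t _ _ _ le_rfl

theorem position_child_setAngle (x : Params N) (F : FamilyIndex N) (t : AddCircle (2 * Real.pi))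
    (b : Bool) : position (setAngle x F t) (F.child b) =
      position x (F.child b) +
        sgn b * ((AddCircle.toCircle t - rotation x F) * halfDiameter x F) := by
  have hangle : (setAngle x F t).2 F = t := Function.update_self _ _ _
  simp only [position_child, center, halfDiameter, rotation, position_parent_setAngle, hangle]
  ring

theorem position_setAngle (x : Params N) (F : FamilyIndex N) (t : AddCircle (2 * Real.pi))
    {a : Member N} (ha : (a.1 : ℕ) ≤ F.1 + 1) (hF : ∀ b, a ≠ F.child b) :
    position (setAngle x F t) a = position x a := by
  rcases Nat.le_succ_iff.1 ha with hle | heq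
  · exact place_setAngle_of_le x F t _ _ _ hle
  · obtain ⟨F', b, rfl⟩ := FamilyIndex.exists_eq_child (a := a) (by omega)
    have hage : (F'.1 : ℕ) = F.1 := Nat.succ_injective heq
    have hne : F' ≠ F := by
      rintro rfl
      exact hF b rfl
    have hparent (b : Bool) :
        position (setAngle x F t) (F'.parent b) = position x (F'.parent b) :=
      place_setAngle_of_le x F t _ _ _ hage.le
    have hangle : (setAngle x F t).2 F' = x.2 F' := Function.update_of_ne hne _ _
    simp only [position_child, center, halfDiameter, rotation, hparent, hangle]

/-- No member of a generation after `m` is in the support of `l`. -/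
def SupportedUpTo (m : ℕ) (l : Member N → ℤ) : Prop := ∀ a : Member N, m < (a.1 : ℕ) → l a = 0

theorem supportedUpTo_card (l : Member N → ℤ) : SupportedUpTo N l :=
  fun a ha => absurd a.1.isLt ha.le.not_gt

/-- The difference of the coefficients of the two children. -/
def childDiff (F : FamilyIndex N) (l : Member N → ℤ) : ℤ := l (F.child false) - l (F.child true)

theorem linearCombination_eq_add_of_eq_off_pair {α R M : Type*} [Fintype α] [Ring R]
    [AddCommGroup M] [Module R M] {v v' : α → M} {l : α → R} {a b : α} (hab : a ≠ b)
    (h : ∀ c, c ≠ a → c ≠ b → l c ≠ 0 → v' c = v c) :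
    Fintype.linearCombination R v' l =
      Fintype.linearCombination R v l + (l a • (v' a - v a) + l b • (v' b - v b)) := by
  rw [← sub_eq_iff_eq_add']
  simp only [Fintype.linearCombination_apply, smul_sub, ← Finset.sum_sub_distrib]
  refine Fintype.sum_eq_add a b hab fun c hc => ?_
  by_cases hl : l c = 0
  · rw [hl, zero_smul, zero_smul, sub_zero]
  · rw [h c hc.1 hc.2 hl, sub_self]

theorem momentumAt_setAngle {F : FamilyIndex N} {l : Member N → ℤ}
    (hl : SupportedUpTo (F.1 + 1) l) (x : Params N) (t : AddCircle (2 * Real.pi)) :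
    momentumAt (setAngle x F t) l = momentumAt x l +
      childDiff F l * ((AddCircle.toCircle t - rotation x F) * halfDiameter x F) := by
  rw [momentumAt, linearCombination_eq_add_of_eq_off_pair F.child_ne fun a hfalse htrue ha =>
    position_setAngle x F t (not_lt.1 fun h => ha (hl a h)) (Bool.forall_bool.2 ⟨hfalse, htrue⟩)]
  simp only [momentumAt, position_child_setAngle, childDiff, zsmul_eq_mul, sgn, if_true,
    Bool.false_eq_true, if_false]
  push_cast
  ring

theorem energyAt_setAngle {F : FamilyIndex N} {l : Member N → ℤ}
    (hl : SupportedUpTo (F.1 + 1) l) (x : Params N) (t : AddCircle (2 * Real.pi)) :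
    energyAt (setAngle x F t) l = energyAt x l +
      childDiff F l *
        ((AddCircle.toCircle t - rotation x F) * halfDiameter x F * conj (center x F) +
          conj ((AddCircle.toCircle t - rotation x F) * halfDiameter x F) * center x F) := by
  have hpos (a : Member N) (hfalse : a ≠ F.child false) (htrue : a ≠ F.child true)
      (ha : l a ≠ 0) : position (setAngle x F t) a = position x a :=
    position_setAngle x F t (not_lt.1 fun h => ha (hl a h)) (Bool.forall_bool.2 ⟨hfalse, htrue⟩)
  rw [energyAt, linearCombination_eq_add_of_eq_off_pair F.child_ne fun a hfalse htrue ha => by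
    rw [hpos a hfalse htrue ha]]
  simp only [position_child_setAngle]
  simp only [energyAt, position_child, childDiff, zsmul_eq_mul, sgn, if_true, Bool.false_eq_true,
    if_false, map_add, map_sub, map_mul, map_one, map_neg]
  push_cast
  linear_combination ((l (F.child false) : ℂ) + l (F.child true)) * halfDiameter x F *
    conj (halfDiameter x F) * (coe_mul_conj_coe (AddCircle.toCircle t) - rotation_mul_conj x F)

theorem coeff_eq_zero_of_forall_toCircle {A B C : ℂ}
    (h : ∀ t : AddCircle (2 * Real.pi),
      A + AddCircle.toCircle t * B + conj (AddCircle.toCircle t : ℂ) * C = 0) : B = 0 := by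
  have hcircle (u : Circle) : A + u * B + conj (u : ℂ) * C = 0 := by
    obtain ⟨t, rfl⟩ := (AddCircle.homeomorphCircle Real.two_pi_pos.ne').surjective u
    rw [AddCircle.homeomorphCircle_apply]
    exact h t
  obtain ⟨i, hi⟩ : ∃ i : Circle, (i : ℂ) = Complex.I :=
    ⟨⟨Complex.I, by simp [Submonoid.unitSphere]⟩, rfl⟩
  have h_one := hcircle 1
  have h_neg_one := hcircle (-1)
  have h_I := hcircle i
  have h_neg_I := hcircle (-i)
  simp only [Circle.coe_one, Circle.coe_neg, hi, map_one, map_neg, Complex.conj_I]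
    at h_one h_neg_one h_I h_neg_I
  linear_combination (1 / 4 : ℂ) * (h_one - h_neg_one) - Complex.I / 4 * (h_I - h_neg_I) +
    (B - C) / 2 * Complex.I_mul_I

theorem place_zero_angle (y : Label N → ℂ) :
    ∀ (k : ℕ) (h : k < N) (z : Label N), place (y, 0) k h z = y z
  | 0, _, _ => rfl
  | k + 1, h, z => by
    have hz := Function.update_eq_self (⟨k, Nat.lt_sub_of_add_lt h⟩ : Fin (N - 1)) z
    simp only [place, place_zero_angle y k, Pi.zero_apply, AddCircle.toCircle_zero,
      Circle.coe_one]
    split_ifs with hk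
    · rw [hk] at hz
      rw [hz]
      ring
    · rw [Bool.not_eq_true] at hk
      rw [hk] at hz
      rw [hz]
      ring

theorem position_zero_angle (y : Label N → ℂ) (a : Member N) : position (y, 0) a = y a.2 :=
  place_zero_angle y _ _ _

theorem center_zero_angle (F : FamilyIndex N) :
    center (Pi.single (F.endpoint false) 1, 0) F = 1 / 2 := by
  simp [center, position_zero_angle, FamilyIndex.parent, F.endpoint_injective.eq_iff]

theorem halfDiameter_zero_angle (F : FamilyIndex N) :
    halfDiameter (Pi.single (F.endpoint false) 1, 0) F = 1 / 2 := by
  simp [halfDiameter, position_zero_angle, FamilyIndex.parent, F.endpoint_injective.eq_iff]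

/-- The sum of the coefficients of the members with a given label. -/
def labelSum (l : Member N → ℤ) (z : Label N) : ℤ := ∑ k, l (k, z)

theorem momentumAt_zero_angle (l : Member N → ℤ) (z : Label N) :
    momentumAt (Pi.single z 1, 0) l = labelSum l z := by
  simp [momentumAt, Fintype.linearCombination_apply, position_zero_angle, Pi.single_apply,
    Fintype.sum_prod_type, labelSum]

theorem energyAt_zero_angle (l : Member N → ℤ) (z : Label N) :
    energyAt (Pi.single z 1, 0) l = labelSum l z := by
  simp [energyAt, Fintype.linearCombination_apply, position_zero_angle, Pi.single_apply,
    Fintype.sum_prod_type, labelSum]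

theorem labelSum_eq_of_supportedUpTo_zero {l : Member N → ℤ} (hl : SupportedUpTo 0 l)
    {a : Member N} (ha : (a.1 : ℕ) = 0) : labelSum l a.2 = l a :=
  Fintype.sum_eq_single a.1 fun _ hk =>
    hl _ (Nat.pos_of_ne_zero fun hk0 => hk (Fin.ext (hk0.trans ha.symm)))

theorem labelSum_eq_zero_or_one_of_defect {l : Member N → ℤ} (h : ∀ x, defect x l = 0)
    (z : Label N) : labelSum l z = 0 ∨ labelSum l z = 1 := by
  have hdefect := h (Pi.single z 1, 0)
  rw [defect, momentumAt_zero_angle, energyAt_zero_angle, map_intCast] at hdefect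
  have hmul : labelSum l z * (1 - labelSum l z) = 0 := by
    exact_mod_cast (by linear_combination hdefect :
      (labelSum l z : ℂ) * (1 - labelSum l z) = 0)
  exact (mul_eq_zero.1 hmul).imp_right fun h => (sub_eq_zero.1 h).symm

theorem exists_supportedUpTo_of_childDiff_eq_zero {m : ℕ} {l : Member N → ℤ}
    (hl : SupportedUpTo (m + 1) l)
    (h : ∀ F : FamilyIndex N, (F.1 : ℕ) = m → childDiff F l = 0) :
    ∃ n : FamilyIndex N → ℤ, SupportedUpTo m (l - familySum n) := by
  refine ⟨fun F => if (F.1 : ℕ) = m then -l (F.child false) else 0, fun a ha => ?_⟩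
  obtain ⟨F, b, rfl⟩ := FamilyIndex.exists_eq_child (Nat.zero_lt_of_lt ha)
  have hm : m ≤ F.1 := Nat.le_of_lt_succ ha
  have hsucc (n : FamilyIndex N → ℤ) (hn : ∀ F : FamilyIndex N, (F.1 : ℕ) ≠ m → n F = 0) :
      familySum n (F.child b) = -n F := by
    rw [familySum_apply, height_eq_zero (j := (F.child b).1 + 1) fun F' hF' _ => hn F' ?_]
    · exact (zero_sub _).trans (congrArg _ (height_of_mem_ends n (F.endpoint_mem_ends b)))
    · replace hF' : (F'.1 : ℕ) + 1 = F.1 + 1 + 1 := hF'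
      omega
  rw [Pi.sub_apply, hsucc _ fun F' hF' => if_neg hF']
  rcases hm.eq_or_lt with hF | hlt
  · have hsib : l (F.child b) = l (F.child false) := by
      cases b
      exacts [rfl, (sub_eq_zero.1 (h F hF.symm)).symm]
    rw [if_pos hF.symm, hsib, neg_neg, sub_self]
  · rw [if_neg hlt.ne', hl _ (Nat.succ_lt_succ hlt), neg_zero, sub_zero]

/-- Momentum and energy of `l` vanish for all parameters. -/
structure IdenticallyResonant (l : Member N → ℤ) : Prop where
  momentum : ∀ x : Params N, momentumAt x l = 0
  energy : ∀ x : Params N, energyAt x l = 0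

namespace IdenticallyResonant

variable {l : Member N → ℤ}

theorem sub_familySum (h : IdenticallyResonant l) (n : FamilyIndex N → ℤ) :
    IdenticallyResonant (l - familySum n) where
  momentum x := by rw [map_sub, h.momentum, momentumAt_familySum, sub_zero]
  energy x := by rw [map_sub, h.energy, energyAt_familySum, sub_zero]

theorem childDiff_eq_zero {F : FamilyIndex N} (h : IdenticallyResonant l)
    (hl : SupportedUpTo (F.1 + 1) l) : childDiff F l = 0 := by
  let x : Params N := (Pi.single (F.endpoint false) 1, 0)
  have hcoeff : (childDiff F l : ℂ) * (halfDiameter x F * conj (center x F)) = 0 :=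
    coeff_eq_zero_of_forall_toCircle
      (A := -childDiff F l * (rotation x F * halfDiameter x F * conj (center x F) +
        conj (rotation x F * halfDiameter x F) * center x F))
      (C := childDiff F l * (conj (halfDiameter x F) * center x F)) fun t => by
        have henergy := energyAt_setAngle hl x t
        rw [h.energy, h.energy] at henergy
        simp only [map_mul, map_sub] at henergy ⊢
        linear_combination -henergy
  rw [center_zero_angle, halfDiameter_zero_angle] at hcoeff
  simpa using hcoeff

theorem exists_of_supportedUpTo :
    ∀ (m : ℕ) {l : Member N → ℤ}, IdenticallyResonant l → SupportedUpTo m l →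
      ∃ n, l = familySum n
  | 0, l, h, hl => by
    refine ⟨0, funext fun a => ?_⟩
    rw [familySum_zero, Pi.zero_apply]
    rcases Nat.eq_zero_or_pos (a.1 : ℕ) with ha | ha
    · have hzero := momentumAt_zero_angle l a.2
      rw [h.momentum, labelSum_eq_of_supportedUpTo_zero hl ha] at hzero
      exact_mod_cast hzero.symm
    · exact hl a ha
  | m + 1, l, h, hl => by
    obtain ⟨n, hn⟩ := exists_supportedUpTo_of_childDiff_eq_zero hl fun F hF =>
      h.childDiff_eq_zero (hF ▸ hl)
    obtain ⟨n', hn'⟩ := exists_of_supportedUpTo m (h.sub_familySum n) hn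
    exact ⟨n' + n, by rw [familySum_add, ← hn', sub_add_cancel]⟩

end IdenticallyResonant

theorem momentumAt_eq_of_defect {F : FamilyIndex N} {l : Member N → ℤ}
    (h : ∀ x, defect x l = 0) (hl : SupportedUpTo (F.1 + 1) l) (hne : childDiff F l ≠ 0)
    (x : Params N) : momentumAt x l =
      center x F + childDiff F l * (rotation x F * halfDiameter x F) := by
  -- `K` is the part of the momentum that does not depend on the angle of `F`.
  let K (x : Params N) : ℂ := momentumAt x l - childDiff F l * (rotation x F * halfDiameter x F)
  have hcoeff (x : Params N) : halfDiameter x F * conj (center x F - K x) = 0 := by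
    refine (mul_eq_zero.1 ?_).resolve_left (Int.cast_ne_zero (α := ℂ).2 hne)
    refine coeff_eq_zero_of_forall_toCircle
      (A := energyAt x l - K x * conj (K x) -
        childDiff F l * (rotation x F * halfDiameter x F * conj (center x F) +
          conj (rotation x F * halfDiameter x F) * center x F) -
        childDiff F l ^ 2 * (halfDiameter x F * conj (halfDiameter x F)))
      (C := childDiff F l * (conj (halfDiameter x F) * (center x F - K x))) fun t => ?_
    have hdefect := h (setAngle x F t)
    rw [defect, energyAt_setAngle hl, momentumAt_setAngle hl] at hdefect
    simp only [K, map_add, map_sub, map_mul, map_intCast] at hdefect ⊢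
    linear_combination hdefect + (childDiff F l : ℂ) ^ 2 * halfDiameter x F *
      conj (halfDiameter x F) * coe_mul_conj_coe (AddCircle.toCircle t)
  have hK : LiftAnalytic K := (liftAnalytic_momentumAt l).sub <|
    (LiftAnalytic.const _).mul ((LiftAnalytic.toCircle F).mul (liftAnalytic_halfDiameter F))
  have hconj : LiftAnalytic fun x => conj (center x F - K x) :=
    ((liftAnalytic_center F).sub hK).clm_comp Complex.conjCLE.toContinuousLinearMap
  have hcenter : center x F - K x = 0 := by
    rcases (liftAnalytic_halfDiameter F).eq_zero_or_eq_zero_of_mul_eq_zero hconj hcoeff with hd | hc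
    · have hd₀ := hd (Pi.single (F.endpoint false) 1, 0)
      rw [halfDiameter_zero_angle] at hd₀
      norm_num at hd₀
    · exact (map_eq_zero _).1 (hc x)
  linear_combination -hcenter

theorem childDiff_eq_one_or_neg_one_of_defect {F : FamilyIndex N} {l : Member N → ℤ}
    (h : ∀ x, defect x l = 0) (hl : SupportedUpTo (F.1 + 1) l) (hne : childDiff F l ≠ 0) :
    childDiff F l = 1 ∨ childDiff F l = -1 := by
  have hmomentum := momentumAt_eq_of_defect h hl hne (Pi.single (F.endpoint false) 1, 0)
  have hrotation : rotation (Pi.single (F.endpoint false) 1, 0) F = 1 := by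
    simp [rotation]
  rw [momentumAt_zero_angle, center_zero_angle, halfDiameter_zero_angle, hrotation] at hmomentum
  have hlabel : 2 * labelSum l (F.endpoint false) = 1 + childDiff F l := by
    exact_mod_cast (by linear_combination 2 * hmomentum :
      2 * (labelSum l (F.endpoint false) : ℂ) = 1 + childDiff F l)
  have := labelSum_eq_zero_or_one_of_defect h (F.endpoint false)
  omega

theorem exists_momentumAt_eq_child {F : FamilyIndex N} {l : Member N → ℤ}
    (h : ∀ x, defect x l = 0) (hl : SupportedUpTo (F.1 + 1) l) (hne : childDiff F l ≠ 0) :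
    ∃ b, ∀ x, momentumAt x l = position x (F.child b) := by
  rcases childDiff_eq_one_or_neg_one_of_defect h hl hne with hdiff | hdiff
  · exact ⟨false, fun x => by
      rw [momentumAt_eq_of_defect h hl hne, position_child, hdiff]; simp [sgn]⟩
  · exact ⟨true, fun x => by
      rw [momentumAt_eq_of_defect h hl hne, position_child, hdiff]; simp [sgn]⟩

theorem exists_eq_single_of_sum_eq_one {ι : Type*} [Fintype ι] [DecidableEq ι] {f : ι → ℤ}
    (h : ∀ i, f i = 0 ∨ f i = 1) (hsum : ∑ i, f i = 1) : ∃ i, f = Pi.single i 1 := by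
  obtain ⟨i, -, hi⟩ := Finset.exists_ne_zero_of_sum_ne_zero (hsum ▸ one_ne_zero)
  have hi' : f i = 1 := (h i).resolve_left hi
  have hrest : ∑ j ∈ Finset.univ.erase i, f j = 0 := by
    have := Finset.add_sum_erase _ f (Finset.mem_univ i)
    omega
  have hnonneg (j : ι) : 0 ≤ f j := by have := h j; omega
  have hzero := (Finset.sum_eq_zero_iff_of_nonneg fun j _ => hnonneg j).1 hrest
  refine ⟨i, funext fun j => ?_⟩
  by_cases hj : j = i
  · rw [hj, hi', Pi.single_eq_same]
  · rw [hzero j (Finset.mem_erase.2 ⟨hj, Finset.mem_univ j⟩), Pi.single_eq_of_ne hj]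

theorem exists_momentumAt_eq_position :
    ∀ (m : ℕ) {l : Member N → ℤ}, (∀ x, defect x l = 0) → ∑ a, l a = 1 → SupportedUpTo m l →
      ∃ u, ∀ x, momentumAt x l = position x u
  | 0, l, h, hsum, hl => by
    have h01 (a : Member N) : l a = 0 ∨ l a = 1 := by
      rcases Nat.eq_zero_or_pos (a.1 : ℕ) with ha | ha
      · rw [← labelSum_eq_of_supportedUpTo_zero hl ha]
        exact labelSum_eq_zero_or_one_of_defect h a.2
      · exact .inl (hl a ha)
    obtain ⟨u, rfl⟩ := exists_eq_single_of_sum_eq_one h01 hsum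
    exact ⟨u, fun x => by rw [momentumAt_single, Int.cast_one, one_mul]⟩
  | m + 1, l, h, hsum, hl => by
    by_cases hdiff : ∀ F : FamilyIndex N, (F.1 : ℕ) = m → childDiff F l = 0
    · obtain ⟨n, hn⟩ := exists_supportedUpTo_of_childDiff_eq_zero hl hdiff
      have hsum' : ∑ a, (l - familySum n) a = 1 := by
        simp only [Pi.sub_apply, Finset.sum_sub_distrib, sum_familySum, hsum, sub_zero]
      obtain ⟨u, hu⟩ := exists_momentumAt_eq_position m
        (fun x => (defect_sub_familySum x l n).trans (h x)) hsum' hn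
      exact ⟨u, fun x => by rw [← hu, map_sub, momentumAt_familySum, sub_zero]⟩
    · push Not at hdiff
      obtain ⟨F, rfl, hne⟩ := hdiff
      obtain ⟨b, hb⟩ := exists_momentumAt_eq_child h hl hne
      exact ⟨F.child b, hb⟩

theorem exists_familySum_of_defect {l : Member N → ℤ} (h : ∀ x, defect x l = 0)
    (hsum : ∑ a, l a = 1) : ∃ u n, l = Pi.single u 1 + familySum n := by
  obtain ⟨u, hu⟩ := exists_momentumAt_eq_position N h hsum (supportedUpTo_card l)
  have hres : IdenticallyResonant (l - Pi.single u 1) := by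
    refine ⟨fun x => ?_, fun x => ?_⟩
    · rw [map_sub, momentumAt_single, hu, Int.cast_one, one_mul, sub_self]
    · have hdefect := h x
      rw [defect, hu] at hdefect
      rw [map_sub, energyAt_single, Int.cast_one, one_mul, hdefect]
  obtain ⟨n, hn⟩ := hres.exists_of_supportedUpTo N (supportedUpTo_card _)
  exact ⟨u, n, by rw [← hn, add_sub_cancel]⟩

/-! ### Combinations of families of small size -/

/-- `|λ| = ∑ |λᵥ|`, for vectors indexed by a finite type. -/
def absSum {ι : Type*} [Fintype ι] (l : ι → ℤ) : ℤ := ∑ i, |l i|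

section AbsSum

variable {ι : Type*} [Fintype ι]

theorem absSum_single [DecidableEq ι] (i : ι) (c : ℤ) : absSum (Pi.single i c) = |c| := by
  rw [absSum, Fintype.sum_eq_single i fun j hj => by rw [Pi.single_eq_of_ne hj, abs_zero],
    Pi.single_eq_same]

theorem absSum_add_le (l m : ι → ℤ) : absSum (l + m) ≤ absSum l + absSum m := by
  rw [absSum, absSum, absSum, ← Finset.sum_add_distrib]
  exact Finset.sum_le_sum fun i _ => abs_add_le _ _

theorem absSum_sub_le (l m : ι → ℤ) : absSum (l - m) ≤ absSum l + absSum m := by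
  rw [absSum, absSum, absSum, ← Finset.sum_add_distrib]
  exact Finset.sum_le_sum fun i _ => abs_sub _ _

theorem sum_mul_le_absSum {σ : ι → ℤ} (hσ : ∀ i, |σ i| ≤ 1) (l : ι → ℤ) :
    ∑ i, σ i * l i ≤ absSum l := by
  refine Finset.sum_le_sum fun i _ => (le_abs_self _).trans ?_
  rw [abs_mul]
  exact mul_le_of_le_one_left (abs_nonneg _) (hσ i)

end AbsSum

namespace FamilyIndex

theorem eq_of_ne_of_mem_ends {F F' : FamilyIndex N} {z z' : Label N} (hz : z ≠ z')
    (hzF : z ∈ F.ends) (hzF' : z' ∈ F.ends) (hz'F : z ∈ F'.ends) (hz'F' : z' ∈ F'.ends) :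
    F = F' := by
  have age_eq {G : FamilyIndex N} {i : Fin (N - 1)} (hi : z i ≠ z' i) (h : z ∈ G.ends)
      (h' : z' ∈ G.ends) : i = G.1 := by
    by_contra hne
    obtain ⟨b, rfl⟩ := mem_ends.1 h
    obtain ⟨b', rfl⟩ := mem_ends.1 h'
    exact hi (by simp only [endpoint, hne, dite_false])
  obtain ⟨i, hi⟩ := Function.ne_iff.1 hz
  exact eq_of_mem_ends ((age_eq hi hzF hzF').symm.trans (age_eq hi hz'F hz'F')) hzF hz'F

theorem three_le_card_union {F F' : FamilyIndex N} (h : F ≠ F') :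
    3 ≤ (F.ends ∪ F'.ends).card := by
  have hinter : (F.ends ∩ F'.ends).card ≤ 1 := by
    refine Finset.card_le_one.2 fun z hz z' hz' => ?_
    by_contra hne
    rw [Finset.mem_inter] at hz hz'
    exact h (eq_of_ne_of_mem_ends hne hz.1 hz'.1 hz.2 hz'.2)
  have hcard := Finset.card_union_add_card_inter F.ends F'.ends
  rw [card_ends, card_ends] at hcard
  omega

end FamilyIndex

/-- The parity of the number of coordinates equal to `true`. -/
def parity (z : Label N) : ZMod 2 := ∑ i, if z i then 1 else 0

theorem parity_endpoint_true (F : FamilyIndex N) :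
    parity (F.endpoint true) = 1 + parity (F.endpoint false) := by
  rw [parity, parity, Fintype.sum_eq_add_sum_compl F.1, Fintype.sum_eq_add_sum_compl F.1]
  simp only [FamilyIndex.endpoint_self, if_true, Bool.false_eq_true, if_false, zero_add]
  congr 1
  refine Finset.sum_congr rfl fun i hi => ?_
  have hne : i ≠ F.1 := by simpa using hi
  simp only [FamilyIndex.endpoint, hne, dite_false]

theorem exists_even_odd_endpoints (F : FamilyIndex N) :
    ∃ z w, z ∈ F.ends ∧ w ∈ F.ends ∧ parity z = 0 ∧ parity w ≠ 0 := by
  have htrue := parity_endpoint_true F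
  have hflip : ∀ a : ZMod 2, a = 0 ∧ 1 + a ≠ 0 ∨ 1 + a = 0 ∧ a ≠ 0 := by decide
  rcases hflip (parity (F.endpoint false)) with h | h <;> rw [← htrue] at h
  · exact ⟨_, _, F.endpoint_mem_ends false, F.endpoint_mem_ends true, h⟩
  · exact ⟨_, _, F.endpoint_mem_ends true, F.endpoint_mem_ends false, h⟩

-- The cube is bipartite, and three vertices of a bipartite graph span at most two edges.
theorem card_families_le_two {S : Finset (FamilyIndex N)} {Z : Finset (Label N)}
    (hZ : Z.card ≤ 3) (hS : ∀ F ∈ S, F.ends ⊆ Z) : S.card ≤ 2 := by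
  choose even odd heven hodd hparity hparity' using exists_even_odd_endpoints (N := N)
  let E := {z ∈ Z | parity z = 0}
  let O := {z ∈ Z | ¬ parity z = 0}
  have hedges : S.card ≤ (E ×ˢ O).card := by
    refine Finset.card_le_card_of_injOn (fun F => (even F, odd F)) (fun F hF => ?_)
      fun F _ F' _ h => ?_
    · exact Finset.mem_coe.2 <| Finset.mem_product.2
        ⟨Finset.mem_filter.2 ⟨hS F hF (heven F), hparity F⟩,
          Finset.mem_filter.2 ⟨hS F hF (hodd F), hparity' F⟩⟩
    · obtain ⟨heq, heq'⟩ := Prod.mk.inj h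
      have hne : even F ≠ odd F := fun h => hparity' F (h ▸ hparity F)
      exact FamilyIndex.eq_of_ne_of_mem_ends hne (heven F) (hodd F) (heq ▸ heven F')
        (heq' ▸ hodd F')
  have hcard : E.card + O.card = Z.card := Finset.card_filter_add_card_filter_not _
  rw [Finset.card_product] at hedges
  have hE : E.card ≤ 3 := by omega
  interval_cases E.card <;> omega

/-- The total variation of the heights over a label. -/
def variation (n : FamilyIndex N → ℤ) (z : Label N) : ℤ :=
  ∑ j ∈ Finset.range N, |height n z (j + 1) - height n z j|

theorem absSum_familySum (n : FamilyIndex N → ℤ) :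
    absSum (familySum n) = ∑ z, variation n z := by
  rw [absSum, Fintype.sum_prod_type_right]
  refine Finset.sum_congr rfl fun z _ => ?_
  rw [variation, Finset.sum_range]
  exact Finset.sum_congr rfl fun k _ => by rw [familySum_apply]

theorem sum_le_absSum_familySum {n : FamilyIndex N → ℤ} {f : Label N → ℤ}
    (h : ∀ z, f z ≤ variation n z) : ∑ z, f z ≤ absSum (familySum n) :=
  absSum_familySum n ▸ Finset.sum_le_sum fun z _ => h z

theorem card_mul_le_absSum_familySum {n : FamilyIndex N → ℤ} {U : Finset (Label N)} {c : ℤ}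
    (h : ∀ z ∈ U, c ≤ variation n z) : U.card * c ≤ absSum (familySum n) := by
  rw [absSum_familySum, ← nsmul_eq_mul]
  exact (Finset.card_nsmul_le_sum U _ c h).trans
    (Finset.sum_le_univ_sum_of_nonneg fun z => Finset.sum_nonneg fun _ _ => abs_nonneg _)

theorem abs_sub_le_sum_Ico (h : ℕ → ℤ) {a b : ℕ} (hab : a ≤ b) :
    |h b - h a| ≤ ∑ j ∈ Finset.Ico a b, |h (j + 1) - h j| := by
  rw [← Finset.sum_Ico_sub h hab]
  exact Finset.abs_sum_le_sum_abs _ _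

-- The heights vanish at both ends `0` and `N`.
theorem le_variation (n : FamilyIndex N → ℤ) (z : Label N) {m m' : ℕ} (h : m ≤ N) (h' : m' ≤ N) :
    |height n z m| + |height n z m' - height n z m| + |height n z m'| ≤ variation n z := by
  wlog hm : m ≤ m' generalizing m m'
  · have := this h' h (le_of_not_ge hm)
    rw [abs_sub_comm] at this
    linarith
  have hstart : height n z 0 = 0 := height_eq_zero fun F hF _ => by omega
  have hend : height n z N = 0 := height_eq_zero fun F hF _ => by omega
  have hfirst := abs_sub_le_sum_Ico (height n z) (Nat.zero_le m)
  have hmiddle := abs_sub_le_sum_Ico (height n z) hm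
  have hlast := abs_sub_le_sum_Ico (height n z) h'
  rw [hstart, sub_zero] at hfirst
  rw [hend, zero_sub, abs_neg] at hlast
  rw [variation, Finset.range_eq_Ico, ← Finset.sum_Ico_consecutive _ (Nat.zero_le m) h,
    ← Finset.sum_Ico_consecutive _ hm h']
  linarith

theorem two_mul_abs_le_variation (n : FamilyIndex N → ℤ) {F : FamilyIndex N} {z : Label N}
    (hz : z ∈ F.ends) : 2 * |n F| ≤ variation n z := by
  have hF : F.1 + 1 ≤ N := by omega
  have := le_variation n z hF hF
  rw [height_of_mem_ends n hz, sub_self, abs_zero] at this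
  linarith

theorem two_le_variation {n : FamilyIndex N → ℤ} {F : FamilyIndex N} (hF : n F ≠ 0)
    {z : Label N} (hz : z ∈ F.ends) : 2 ≤ variation n z := by
  have := two_mul_abs_le_variation n hz
  have := Int.one_le_abs hF
  linarith

theorem four_le_variation_of_opposite {n : FamilyIndex N → ℤ} {F F' : FamilyIndex N}
    (hF : n F = 1) (hF' : n F' = -1) {z : Label N} (hz : z ∈ F.ends) (hz' : z ∈ F'.ends) :
    4 ≤ variation n z := by
  have := le_variation n z (m := F.1 + 1) (m' := F'.1 + 1) (by omega) (by omega)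
  rwa [height_of_mem_ends n hz, height_of_mem_ends n hz', hF, hF'] at this

theorem six_le_absSum {n : FamilyIndex N → ℤ} {F F' : FamilyIndex N} (hF : n F ≠ 0)
    (hF' : n F' ≠ 0) (h : F ≠ F') : 6 ≤ absSum (familySum n) := by
  have hcard : (3 : ℤ) ≤ (F.ends ∪ F'.ends).card := by
    exact_mod_cast FamilyIndex.three_le_card_union h
  have := card_mul_le_absSum_familySum (n := n) (U := F.ends ∪ F'.ends) (c := 2) fun z hz =>
    (Finset.mem_union.1 hz).elim (two_le_variation hF) (two_le_variation hF')
  linarith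

theorem eight_le_absSum_of_opposite {n : FamilyIndex N → ℤ} {F F' : FamilyIndex N}
    (hF : n F = 1) (hF' : n F' = -1) : 8 ≤ absSum (familySum n) := by
  have hpoint (z : Label N) :
      (if z ∈ F.ends then 2 else 0) + (if z ∈ F'.ends then 2 else 0) ≤ variation n z := by
    split_ifs with hz hz' hz'
    · exact four_le_variation_of_opposite hF hF' hz hz'
    · exact two_le_variation (by omega) hz
    · exact two_le_variation (F := F') (by omega) hz'
    · exact Finset.sum_nonneg fun _ _ => abs_nonneg _
  refine le_trans (le_of_eq ?_) (sum_le_absSum_familySum hpoint)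
  simp [Finset.sum_add_distrib, FamilyIndex.card_ends]

theorem eq_one_or_neg_one_of_absSum_le {n : FamilyIndex N → ℤ} (h : absSum (familySum n) ≤ 6)
    {F : FamilyIndex N} (hF : n F ≠ 0) : n F = 1 ∨ n F = -1 := by
  have := card_mul_le_absSum_familySum (n := n) (U := F.ends) (c := 2 * |n F|) fun z hz =>
    two_mul_abs_le_variation n hz
  rw [F.card_ends] at this
  have hle : |n F| ≤ 1 := by omega
  rw [abs_le] at hle
  omega

theorem card_filter_ne_zero_le_two {n : FamilyIndex N → ℤ} (h : absSum (familySum n) ≤ 6) :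
    (Finset.univ.filter fun F => n F ≠ 0).card ≤ 2 := by
  set S := Finset.univ.filter fun F => n F ≠ 0
  have hcard := card_mul_le_absSum_familySum (n := n) (U := S.biUnion FamilyIndex.ends) (c := 2)
    fun z hz => by
      obtain ⟨F, hF, hz⟩ := Finset.mem_biUnion.1 hz
      exact two_le_variation (Finset.mem_filter.1 hF).2 hz
  exact card_families_le_two (Z := S.biUnion FamilyIndex.ends) (by omega) fun F hF =>
    Finset.subset_biUnion_of_mem FamilyIndex.ends hF

theorem familySum_eq_of_absSum_le_six {n : FamilyIndex N → ℤ} (h : absSum (familySum n) ≤ 6) :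
    familySum n = 0 ∨
    (∃ F : FamilyIndex N, familySum n = F.vec ∨ familySum n = -F.vec) ∨
    (6 ≤ absSum (familySum n) ∧ ∃ F F' : FamilyIndex N, F ≠ F' ∧
      (familySum n = F.vec + F'.vec ∨ familySum n = -(F.vec + F'.vec))) := by
  have hcard := card_filter_ne_zero_le_two h
  have hsum : familySum n = ∑ F with n F ≠ 0, n F • FamilyIndex.vec F :=
    (Finset.sum_filter_of_ne (p := fun F => n F ≠ 0) fun F _ hF h0 =>
      hF (by rw [h0, zero_smul])).symm
  have hmem (F : FamilyIndex N) : F ∈ (Finset.univ.filter fun F => n F ≠ 0) ↔ n F ≠ 0 := by simp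
  generalize (Finset.univ.filter fun F => n F ≠ 0) = S at hcard hsum hmem
  obtain hS | hS | hS : S.card = 0 ∨ S.card = 1 ∨ S.card = 2 := by omega
  · exact .inl (by rw [hsum, Finset.card_eq_zero.1 hS, Finset.sum_empty])
  · obtain ⟨F, rfl⟩ := Finset.card_eq_one.1 hS
    refine .inr (.inl ⟨F, ?_⟩)
    rw [hsum, Finset.sum_singleton]
    exact (eq_one_or_neg_one_of_absSum_le h ((hmem F).1 (by simp))).imp
      (fun hF => by rw [hF, one_smul]) fun hF => by rw [hF, neg_one_smul]
  · obtain ⟨F, F', hne, rfl⟩ := Finset.card_eq_two.1 hS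
    have hF := (hmem F).1 (by simp)
    have hF' := (hmem F').1 (by simp)
    refine .inr (.inr ⟨six_le_absSum hF hF' hne, F, F', hne, ?_⟩)
    rw [hsum, Finset.sum_pair hne]
    rcases eq_one_or_neg_one_of_absSum_le h hF with hF | hF <;>
      rcases eq_one_or_neg_one_of_absSum_le h hF' with hF' | hF'
    · exact .inl (by rw [hF, hF', one_smul, one_smul])
    · exact absurd (eight_le_absSum_of_opposite hF hF') (by omega)
    · exact absurd (eight_le_absSum_of_opposite hF' hF) (by omega)
    · exact .inr (by rw [hF, hF', neg_one_smul, neg_one_smul, neg_add])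

-- Test against the sign that is `-1` exactly on the children of `F`.
theorem five_le_absSum_add_vec {F : FamilyIndex N} {u : Member N} (h : ∀ b, u ≠ F.child b) :
    5 ≤ absSum (F.vec + Pi.single u 1) := by
  classical
  have hsign := sum_mul_le_absSum (σ := fun a => if ∃ b, a = F.child b then -1 else 1)
    (fun a => by split_ifs <;> simp) (F.vec + Pi.single u 1)
  simpa [FamilyIndex.vec, mul_add, mul_sub, Finset.sum_add_distrib, Finset.sum_sub_distrib,
    Pi.single_apply, h, F.parent_ne_child, FamilyIndex.child_inj] using hsign

theorem five_le_absSum_sub_vec {F : FamilyIndex N} {u : Member N} (h : ∀ b, u ≠ F.parent b) :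
    5 ≤ absSum (-F.vec + Pi.single u 1) := by
  classical
  have hsign := sum_mul_le_absSum (σ := fun a => if ∃ b, a = F.parent b then -1 else 1)
    (fun a => by split_ifs <;> simp) (-F.vec + Pi.single u 1)
  simpa [FamilyIndex.vec, mul_add, mul_sub, Finset.sum_add_distrib, Finset.sum_sub_distrib,
    Pi.single_apply, h, fun b b' => (F.parent_ne_child b b').symm, FamilyIndex.parent_inj]
    using hsign

/-- The vectors `e_u + ∑ n_F λ^F` of size at most five, which correspond to the four cases in the
definition of non-degeneracy. -/
inductive UnitForm (l : Member N → ℤ) : Prop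
  | single (u : Member N) (h : l = Pi.single u 1)
  | parents (F : FamilyIndex N) (b : Bool) (h : l = Pi.single (F.parent false) 1 +
      Pi.single (F.parent true) 1 - Pi.single (F.child b) 1)
  | children (F : FamilyIndex N) (b : Bool) (h : l = Pi.single (F.child false) 1 +
      Pi.single (F.child true) 1 - Pi.single (F.parent b) 1)
  | family (u : Member N) (F : FamilyIndex N) (hsum : 5 ≤ absSum l)
      (h : l = F.vec + Pi.single u 1 ∨ l = -F.vec + Pi.single u 1)
  | couple (u : Member N) (F F' : FamilyIndex N) (hne : F ≠ F') (hsum : 5 ≤ absSum l)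
      (hsum' : absSum (l - Pi.single u 1) ≤ 6)
      (h : l - Pi.single u 1 = F.vec + F'.vec ∨ l - Pi.single u 1 = -(F.vec + F'.vec))

theorem unitForm_vec_add_single (F : FamilyIndex N) (u : Member N) :
    UnitForm (F.vec + Pi.single u 1) := by
  by_cases hu : ∀ b, u ≠ F.child b
  · exact .family u F (five_le_absSum_add_vec hu) (.inl rfl)
  · push Not at hu
    obtain ⟨b, rfl⟩ := hu
    refine .parents F (!b) ?_
    cases b <;> simp only [FamilyIndex.vec, Bool.not_false, Bool.not_true] <;> abel

theorem unitForm_neg_vec_add_single (F : FamilyIndex N) (u : Member N) :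
    UnitForm (-F.vec + Pi.single u 1) := by
  by_cases hu : ∀ b, u ≠ F.parent b
  · exact .family u F (five_le_absSum_sub_vec hu) (.inr rfl)
  · push Not at hu
    obtain ⟨b, rfl⟩ := hu
    refine .children F (!b) ?_
    cases b <;> simp only [FamilyIndex.vec, Bool.not_false, Bool.not_true] <;> abel

theorem unitForm_single_add_familySum {u : Member N} {n : FamilyIndex N → ℤ}
    (h : absSum (Pi.single u 1 + familySum n) ≤ 5) : UnitForm (Pi.single u 1 + familySum n) := by
  have hsub := absSum_sub_le (Pi.single u 1 + familySum n) (Pi.single u 1)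
  rw [add_sub_cancel_left, absSum_single, abs_one] at hsub
  rcases familySum_eq_of_absSum_le_six (n := n) (by omega) with
    hn | ⟨F, hn | hn⟩ | ⟨hsix, F, F', hne, hn⟩
  · exact .single u (by rw [hn, add_zero])
  · rw [hn, add_comm]
    exact unitForm_vec_add_single F u
  · rw [hn, add_comm]
    exact unitForm_neg_vec_add_single F u
  · refine .couple u F F' hne (by omega) ?_ ?_ <;> rw [add_sub_cancel_left]
    exacts [by omega, hn]

/-! ### The exceptional set -/

/-- The vectors to which the non-degeneracy condition applies and whose defect does not vanish
identically. -/
def excludedVectors (N : ℕ) : Set (Member N → ℤ) :=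
  {l | ∑ a, l a = 1 ∧ absSum l ≤ 5 ∧ ¬ ∀ x, defect x l = 0}

theorem finite_excludedVectors : (excludedVectors N).Finite := by
  refine (Set.finite_Icc (fun _ : Member N => (-5 : ℤ)) fun _ => 5).subset fun l hl => ?_
  have hbound (a : Member N) : |l a| ≤ 5 :=
    (Finset.single_le_sum (f := fun a => |l a|) (fun _ _ => abs_nonneg _)
      (Finset.mem_univ a)).trans hl.2.1
  exact ⟨fun a => (abs_le.1 (hbound a)).1, fun a => (abs_le.1 (hbound a)).2⟩

/-- The exceptional set of the theorem: the parameters at which the defect of an excluded vector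
vanishes. -/
def degenerateSet (N : ℕ) : Set (Params N) := ⋃ l ∈ excludedVectors N, {x | defect x l = 0}

theorem isClosed_degenerateSet : IsClosed (degenerateSet N) :=
  finite_excludedVectors.isClosed_biUnion fun l _ =>
    isClosed_singleton.preimage (liftAnalytic_defect l).continuous

theorem volume_degenerateSet : MeasureTheory.volume (degenerateSet N) = 0 := by
  refine (MeasureTheory.measure_biUnion_null_iff finite_excludedVectors.countable).2 fun l hl => ?_
  obtain ⟨x₀, hx₀⟩ := not_forall.1 hl.2.2
  exact (liftAnalytic_defect l).volume_zeros hx₀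

theorem UnitForm.apply_le_one {l : Member N → ℤ} (h : UnitForm l) (hsum : absSum l < 5)
    (a : Member N) : l a ≤ 1 := by
  have triple_le {p q r : Member N} (hpq : p ≠ q) :
      (Pi.single p 1 + Pi.single q 1 - Pi.single r 1 : Member N → ℤ) a ≤ 1 := by
    simp only [Pi.add_apply, Pi.sub_apply, Pi.single_apply]
    grind
  rcases h with ⟨u, rfl⟩ | ⟨F, b, rfl⟩ | ⟨F, b, rfl⟩ | ⟨_, _, hfive, -⟩ |
    ⟨_, _, _, -, hfive, -, -⟩
  · rw [Pi.single_apply]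
    split_ifs <;> norm_num
  · exact triple_le F.parent_ne
  · exact triple_le F.child_ne
  all_goals exact absurd hsum hfive.not_gt

theorem absSum_add_single_of_neg {ι : Type*} [Fintype ι] [DecidableEq ι] {l : ι → ℤ} {i : ι}
    (h : l i < 0) : absSum (l + Pi.single i 1) = absSum l - 1 := by
  have hpoint (j : ι) : |l j + (Pi.single i 1 : ι → ℤ) j| = |l j| - (Pi.single i 1 : ι → ℤ) j := by
    rcases eq_or_ne j i with rfl | hj
    · rw [Pi.single_eq_same, abs_of_neg h, abs_of_nonpos (by omega)]
      ring
    · rw [Pi.single_eq_of_ne hj, add_zero, sub_zero]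
  simp only [absSum, Pi.add_apply, hpoint, Finset.sum_sub_distrib, Fintype.sum_pi_single']

section Generic

variable {x : Params N}

theorem exists_familySum_of_notMem (hx : x ∉ degenerateSet N) {l : Member N → ℤ}
    (hsum : ∑ a, l a = 1) (h5 : absSum l ≤ 5) (h0 : defect x l = 0) :
    ∃ u n, l = Pi.single u 1 + familySum n := by
  refine exists_familySum_of_defect ?_ hsum
  by_contra h
  exact hx (Set.mem_biUnion (show l ∈ excludedVectors N from ⟨hsum, h5, h⟩) h0)

theorem unitForm_of_notMem (hx : x ∉ degenerateSet N) {l : Member N → ℤ}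
    (hsum : ∑ a, l a = 1) (h5 : absSum l ≤ 5) (h0 : defect x l = 0) : UnitForm l := by
  obtain ⟨u, n, rfl⟩ := exists_familySum_of_notMem hx hsum h5 h0
  exact unitForm_single_add_familySum h5

-- If `a` and `b` are at the same place, then the defect of `2 e_a - e_b` vanishes.
theorem position_injective (hx : x ∉ degenerateSet N) : Function.Injective (position x) := by
  intro a b hab
  by_contra hne
  have habs : absSum (Pi.single a 2 - Pi.single b 1 : Member N → ℤ) ≤ 3 := by
    have := absSum_sub_le (Pi.single a 2) (Pi.single b 1 : Member N → ℤ)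
    rwa [absSum_single, absSum_single] at this
  have hdefect : defect x (Pi.single a 2 - Pi.single b 1) = 0 := by
    simp only [defect, map_sub, map_mul, momentumAt_single, energyAt_single, hab, map_intCast]
    push_cast
    ring
  have hform := unitForm_of_notMem hx (by simp [Finset.sum_sub_distrib]) (by omega) hdefect
  have := hform.apply_le_one (by omega) a
  simp [hne] at this

-- Adding a basis vector at a negative coefficient gives a vector of mass one and size at most five.
theorem eq_familySum_of_resonant (hx : x ∉ degenerateSet N) {l : Member N → ℤ}
    (hsum : ∑ a, l a = 0) (h6 : absSum l ≤ 6) (hmomentum : momentumAt x l = 0)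
    (henergy : energyAt x l = 0) : ∃ n, l = familySum n := by
  by_cases hl : ∀ a, 0 ≤ l a
  · refine ⟨0, ?_⟩
    rw [familySum_zero]
    exact funext fun a =>
      (Finset.sum_eq_zero_iff_of_nonneg fun a _ => hl a).1 hsum a (Finset.mem_univ a)
  · push Not at hl
    obtain ⟨a, ha⟩ := hl
    have hsum' : ∑ b, (l + Pi.single a 1 : Member N → ℤ) b = 1 := by
      simp [Finset.sum_add_distrib, hsum]
    have hdefect : defect x (l + Pi.single a 1) = 0 := by
      simp [defect, hmomentum, henergy]
    obtain ⟨u, n, h⟩ := exists_familySum_of_notMem hx hsum'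
      (by rw [absSum_add_single_of_neg ha]; omega) hdefect
    have hposition := congrArg (momentumAt x) h
    rw [map_add, map_add, hmomentum, momentumAt_familySum, momentumAt_single, momentumAt_single,
      zero_add, add_zero, Int.cast_one, one_mul, one_mul] at hposition
    obtain rfl := position_injective hx hposition
    exact ⟨n, add_right_cancel (h.trans (add_comm _ _))⟩

theorem exists_vec_of_resonant (hx : x ∉ degenerateSet N) {l : Member N → ℤ} (hl : l ≠ 0)
    (hsum : ∑ a, l a = 0) (h5 : absSum l ≤ 5) (hmomentum : momentumAt x l = 0)
    (henergy : energyAt x l = 0) : ∃ F : FamilyIndex N, l = F.vec ∨ l = -F.vec := by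
  obtain ⟨n, rfl⟩ := eq_familySum_of_resonant hx hsum (by omega) hmomentum henergy
  rcases familySum_eq_of_absSum_le_six (n := n) (by omega) with h | h | ⟨hsix, -⟩
  · exact absurd h hl
  · exact h
  · omega

/-! ### Passage to the plane -/

/-- The vector indexed by the points of the plane that corresponds to a vector indexed by the
members, when the members are at the positions given by the parameters `x`. -/
def toPlane (x : Params N) : (Member N → ℤ) →+ (ℂ →₀ ℤ) :=
  (Finsupp.mapDomain.addMonoidHom (position x)).comp
    (Finsupp.linearEquivFunOnFinite ℤ ℤ (Member N)).symm.toLinearMap.toAddMonoidHom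

theorem toPlane_single (x : Params N) (a : Member N) (c : ℤ) :
    toPlane x (Pi.single a c) = Finsupp.single (position x a) c := by
  simp [toPlane, Finsupp.mapDomain_single]

theorem toPlane_apply (hinj : Function.Injective (position x)) (l : Member N → ℤ)
    (a : Member N) : toPlane x l (position x a) = l a :=
  Finsupp.mapDomain_apply hinj _ _

theorem toPlane_apply_of_notMem_range (l : Member N → ℤ) {v : ℂ}
    (hv : v ∉ Set.range (position x)) : toPlane x l v = 0 :=
  Finsupp.mapDomain_of_notMem_range _ _ hv

theorem allPoints_generations (x : Params N) :
    allPoints (generations x) = Set.range (position x) := by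
  ext v
  simp [allPoints, generations]

theorem position_mem_allPoints (x : Params N) (a : Member N) :
    position x a ∈ allPoints (generations x) :=
  allPoints_generations x ▸ Set.mem_range_self a

theorem support_toPlane_subset (l : Member N → ℤ) :
    ((toPlane x l).support : Set ℂ) ⊆ allPoints (generations x) := by
  rw [allPoints_generations]
  intro v hv
  by_contra hrange
  exact Finsupp.mem_support_iff.1 hv (toPlane_apply_of_notMem_range l hrange)

theorem exists_toPlane_eq (hinj : Function.Injective (position x)) {l : ℂ →₀ ℤ}
    (hl : (l.support : Set ℂ) ⊆ allPoints (generations x)) : ∃ m, toPlane x m = l := by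
  rw [allPoints_generations] at hl
  refine ⟨fun a => l (position x a), Finsupp.ext fun v => ?_⟩
  by_cases hv : v ∈ Set.range (position x)
  · obtain ⟨a, rfl⟩ := hv
    exact toPlane_apply hinj _ a
  · rw [toPlane_apply_of_notMem_range _ hv]
    exact (Finsupp.notMem_support_iff.1 fun h => hv (hl h)).symm

theorem sum_toPlane {M : Type*} [AddCommMonoid M] (hinj : Function.Injective (position x))
    (l : Member N → ℤ) {g : ℂ → ℤ → M} (hg : ∀ v, g v 0 = 0) :
    (toPlane x l).sum g = ∑ a, g (position x a) (l a) :=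
  (Finsupp.sum_mapDomain_index_inj hinj).trans (Finsupp.sum_fintype _ _ fun _ => hg _)

theorem mass_toPlane (hinj : Function.Injective (position x)) (l : Member N → ℤ) :
    mass (toPlane x l) = ∑ a, l a :=
  sum_toPlane hinj l fun _ => rfl

theorem size_toPlane (hinj : Function.Injective (position x)) (l : Member N → ℤ) :
    size (toPlane x l) = absSum l :=
  sum_toPlane hinj l fun _ => abs_zero

theorem momentum_toPlane (hinj : Function.Injective (position x)) (l : Member N → ℤ) :
    momentum (toPlane x l) = momentumAt x l := by
  simp [momentum, sum_toPlane hinj l, momentumAt, Fintype.linearCombination_apply]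

theorem energy_toPlane (hinj : Function.Injective (position x)) (l : Member N → ℤ) :
    (energy (toPlane x l) : ℂ) = energyAt x l := by
  simp [energy, sum_toPlane hinj l, energyAt, Fintype.linearCombination_apply, Complex.mul_conj']

theorem defect_eq (hinj : Function.Injective (position x)) (l : Member N → ℤ) :
    defect x l = ((energy (toPlane x l) - ‖momentum (toPlane x l)‖ ^ 2 : ℝ) : ℂ) := by
  rw [defect, ← energy_toPlane hinj, ← momentum_toPlane hinj, Complex.mul_conj']
  push_cast
  rfl

/-- The list of the positions of the members of an abstract family. The first parent and the first
child are those with coordinate `b` and `c`: the four choices give the four trivial permutations. -/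
def quad (x : Params N) (F : FamilyIndex N) (b c : Bool) : Quad :=
  ⟨position x (F.parent b), position x (F.parent !b), position x (F.child c),
    position x (F.child !c)⟩

theorem toPlane_vec (x : Params N) (F : FamilyIndex N) (b c : Bool) :
    toPlane x F.vec = (quad x F b c).vec := by
  simp only [FamilyIndex.vec, map_add, map_sub, toPlane_single, Quad.vec, quad]
  cases b <;> cases c <;> simp only [Bool.not_false, Bool.not_true] <;> abel

theorem parent_mem_points_quad (x : Params N) (F : FamilyIndex N) (b b' c : Bool) :
    position x (F.parent b') ∈ (quad x F b c).points := by
  cases b <;> cases b' <;> simp [Quad.points, quad]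

theorem child_mem_points_quad (x : Params N) (F : FamilyIndex N) (b c c' : Bool) :
    position x (F.child c') ∈ (quad x F b c).points := by
  cases c <;> cases c' <;> simp [Quad.points, quad]

theorem mem_ends_of_mem_points_quad (hinj : Function.Injective (position x)) {a : Member N}
    {F : FamilyIndex N} {b c : Bool} (h : position x a ∈ (quad x F b c).points) :
    a.2 ∈ F.ends := by
  simp only [Quad.points, quad, Set.mem_insert_iff, Set.mem_singleton_iff, hinj.eq_iff] at h
  rcases h with rfl | rfl | rfl | rfl <;> exact F.endpoint_mem_ends _

theorem isFamily_quad (hinj : Function.Injective (position x)) (F : FamilyIndex N) (b c : Bool) :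
    IsFamily (generations x) F.1 (quad x F b c) where
  age_lt := by omega
  parent₁ := ⟨_, rfl⟩
  parent₂ := ⟨_, rfl⟩
  child₁ := ⟨_, rfl⟩
  child₂ := ⟨_, rfl⟩
  sum_eq := by
    simp only [quad, position_parent, position_child]
    cases b <;> cases c <;> simp only [sgn, Bool.not_false, Bool.not_true, if_true, if_false,
      Bool.false_eq_true] <;> ring
  sum_sq_eq := by
    have henergy := energyAt_vec x F
    simp only [FamilyIndex.vec, map_add, map_sub, energyAt_single, Complex.mul_conj',
      Int.cast_one, one_mul] at henergy
    have hfalse : ‖position x (F.parent false)‖ ^ 2 + ‖position x (F.parent true)‖ ^ 2 =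
        ‖position x (F.child false)‖ ^ 2 + ‖position x (F.child true)‖ ^ 2 := by
      exact_mod_cast (by linear_combination henergy :
        (‖position x (F.parent false)‖ ^ 2 + ‖position x (F.parent true)‖ ^ 2 : ℂ) =
          ‖position x (F.child false)‖ ^ 2 + ‖position x (F.child true)‖ ^ 2)
    cases b <;> cases c <;> simp only [quad, Bool.not_false, Bool.not_true] <;> linarith
  nondeg := by
    simp [quad, hinj.eq_iff, FamilyIndex.parent_inj, FamilyIndex.child_inj,
      FamilyIndex.parent_ne_child]

theorem trivialPerm_quad (x : Params N) (F : FamilyIndex N) (b b' c c' : Bool) :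
    (quad x F b c).TrivialPerm (quad x F b' c') := by
  cases b <;> cases b' <;> cases c <;> cases c' <;> simp [Quad.TrivialPerm, quad]

theorem eq_of_trivialPerm_quad (hinj : Function.Injective (position x)) {F F' : FamilyIndex N}
    {b b' c c' : Bool} (h : (quad x F b c).TrivialPerm (quad x F' b' c')) : F = F' := by
  have hparent : ∃ s, position x (F'.parent b') = position x (F.parent s) := by
    rcases h with h | h | h | h <;> exact ⟨_, congrArg Quad.p₁ h⟩
  obtain ⟨s, hs⟩ := hparent
  exact (FamilyIndex.parent_inj.1 (hinj hs)).1.symm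

/-- The integer vector `e_a + e_b - e_c - e_d` of four members. -/
def rectangleVec (a b c d : Member N) : Member N → ℤ :=
  Pi.single a 1 + Pi.single b 1 - Pi.single c 1 - Pi.single d 1

theorem absSum_rectangleVec_le (a b c d : Member N) : absSum (rectangleVec a b c d) ≤ 4 := by
  have hab := absSum_add_le (Pi.single a 1) (Pi.single b 1 : Member N → ℤ)
  have habc := absSum_sub_le (Pi.single a 1 + Pi.single b 1) (Pi.single c 1 : Member N → ℤ)
  have habcd := absSum_sub_le (Pi.single a 1 + Pi.single b 1 - Pi.single c 1)
    (Pi.single d 1 : Member N → ℤ)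
  simp only [absSum_single, abs_one] at hab habc habcd
  rw [rectangleVec]
  omega

theorem rectangleVec_apply {a b c d : Member N} (h : [a, b, c, d].Nodup) :
    (rectangleVec a b c d a = 1 ∧ rectangleVec a b c d b = 1) ∧
      rectangleVec a b c d c = -1 ∧ rectangleVec a b c d d = -1 := by
  simp only [rectangleVec, Pi.add_apply, Pi.sub_apply, Pi.single_apply]
  grind

namespace FamilyIndex

theorem eq_parent_child_of_rectangleVec_eq {F : FamilyIndex N} {a b c d : Member N}
    (hnodup : [a, b, c, d].Nodup) (h : rectangleVec a b c d = F.vec) :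
    ∃ s t, a = F.parent s ∧ b = F.parent (!s) ∧ c = F.child t ∧ d = F.child !t := by
  obtain ⟨⟨ha, hb⟩, hc, hd⟩ := rectangleVec_apply hnodup
  rw [h, vec_eq_one_iff] at ha hb
  rw [h, vec_eq_neg_one_iff] at hc hd
  obtain ⟨s, rfl⟩ := ha
  obtain ⟨s', rfl⟩ := hb
  obtain ⟨t, rfl⟩ := hc
  obtain ⟨t', rfl⟩ := hd
  have hs : s' = !s := by
    rw [Bool.eq_not]
    rintro rfl
    simp at hnodup
  have ht : t' = !t := by
    rw [Bool.eq_not]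
    rintro rfl
    simp at hnodup
  exact ⟨s, t, rfl, by rw [hs], rfl, by rw [ht]⟩

theorem rectangleVec_ne_neg_vec (F : FamilyIndex N) {a b c d : Member N}
    (hnodup : [a, b, c, d].Nodup) (hgen : (c.1 : ℕ) = a.1 + 1) :
    rectangleVec a b c d ≠ -F.vec := by
  intro h
  obtain ⟨⟨ha, -⟩, hc, -⟩ := rectangleVec_apply hnodup
  rw [h, Pi.neg_apply, neg_eq_iff_eq_neg, vec_eq_neg_one_iff] at ha
  rw [h, Pi.neg_apply, neg_inj, vec_eq_one_iff] at hc
  obtain ⟨s, rfl⟩ := ha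
  obtain ⟨t, rfl⟩ := hc
  simp only [parent, child, parentGen, childGen] at hgen
  omega

end FamilyIndex

theorem exists_rectangleVec_eq (hx : x ∉ degenerateSet N) {a b c d : Member N}
    (hnodup : [a, b, c, d].Nodup)
    (hsum : position x a + position x b = position x c + position x d)
    (hsq : ‖position x a‖ ^ 2 + ‖position x b‖ ^ 2 = ‖position x c‖ ^ 2 + ‖position x d‖ ^ 2) :
    ∃ F : FamilyIndex N, rectangleVec a b c d = F.vec ∨ rectangleVec a b c d = -F.vec := by
  have hne : rectangleVec a b c d ≠ 0 := fun h => by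
    simpa [h] using (rectangleVec_apply hnodup).1.1
  refine exists_vec_of_resonant hx hne ?_ ?_ ?_ ?_
  · simp [rectangleVec, Finset.sum_add_distrib, Finset.sum_sub_distrib]
  · have := absSum_rectangleVec_le a b c d
    omega
  · simp only [rectangleVec, map_add, map_sub, momentumAt_single]
    push_cast
    linear_combination hsum
  · have hsq' := congrArg (fun r : ℝ => (r : ℂ)) hsq
    simp only [rectangleVec, map_add, map_sub, energyAt_single, Complex.mul_conj']
    push_cast at hsq' ⊢
    linear_combination hsq'

theorem IsFamily.exists_eq_quad (hx : x ∉ degenerateSet N) {i : ℕ} {Q : Quad}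
    (h : IsFamily (generations x) i Q) :
    ∃ (F : FamilyIndex N) (b c : Bool), (F.1 : ℕ) = i ∧ Q = quad x F b c := by
  obtain ⟨p₁, p₂, c₁, c₂⟩ := Q
  obtain ⟨hage, ⟨z₁, rfl⟩, ⟨z₂, rfl⟩, ⟨w₁, rfl⟩, ⟨w₂, rfl⟩, hsum, hsq, hnodup⟩ := h
  replace hnodup : List.Nodup [((⟨i, _⟩, z₁) : Member N), (⟨i, _⟩, z₂), (⟨i + 1, hage⟩, w₁),
      (⟨i + 1, hage⟩, w₂)] := List.Nodup.of_map (position x) hnodup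
  obtain ⟨F, hF | hF⟩ := exists_rectangleVec_eq hx hnodup hsum hsq
  · obtain ⟨s, t, h₁, h₂, h₃, h₄⟩ := F.eq_parent_child_of_rectangleVec_eq hnodup hF
    refine ⟨F, s, t, (congrArg (fun a : Member N => (a.1 : ℕ)) h₁).symm, ?_⟩
    simp only [quad, h₁, h₂, h₃, h₄]
  · exact absurd hF (F.rectangleVec_ne_neg_vec hnodup rfl)

theorem uniqueFamily_of_mem_points_quad (hx : x ∉ degenerateSet N) {a : Member N}
    {F : FamilyIndex N} {b c : Bool} (h : position x a ∈ (quad x F b c).points) :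
    UniqueFamily (generations x) F.1 (position x a) := by
  have hinj := position_injective hx
  refine ⟨quad x F b c, isFamily_quad hinj F b c, h, fun Q hQ hmem => ?_⟩
  obtain ⟨F', b', c', hage, rfl⟩ := hQ.exists_eq_quad hx
  obtain rfl := FamilyIndex.eq_of_mem_ends (Fin.ext hage) (mem_ends_of_mem_points_quad hinj hmem)
    (mem_ends_of_mem_points_quad hinj h)
  exact trivialPerm_quad x F' b b' c c'

theorem AreSpouses.exists_parent (hx : x ∉ degenerateSet N) {v w : ℂ}
    (h : AreSpouses (generations x) v w) :
    ∃ (F : FamilyIndex N) (b : Bool), v = position x (F.parent b) ∧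
      w = position x (F.parent !b) := by
  obtain ⟨i, Q, hQ, rfl, rfl⟩ := h
  obtain ⟨F, b, c, -, rfl⟩ := hQ.exists_eq_quad hx
  exact ⟨F, b, rfl, rfl⟩

theorem AreSiblings.exists_child (hx : x ∉ degenerateSet N) {v w : ℂ}
    (h : AreSiblings (generations x) v w) :
    ∃ (F : FamilyIndex N) (c : Bool), v = position x (F.child c) ∧
      w = position x (F.child !c) := by
  obtain ⟨i, Q, hQ, rfl, rfl⟩ := h
  obtain ⟨F, b, c, -, rfl⟩ := hQ.exists_eq_quad hx
  exact ⟨F, c, rfl, rfl⟩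

-- Two families with two labels in common coincide.
theorem AreSpouses.not_areSiblings (hx : x ∉ degenerateSet N) {v w : ℂ}
    (h : AreSpouses (generations x) v w) : ¬ AreSiblings (generations x) v w := by
  have hinj := position_injective hx
  intro h'
  obtain ⟨F, b, rfl, rfl⟩ := h.exists_parent hx
  obtain ⟨F', c, hv, hw⟩ := h'.exists_child hx
  have hb : F.endpoint b = F'.endpoint c := congrArg Prod.snd (hinj hv)
  have hnotb : F.endpoint (!b) = F'.endpoint (!c) := congrArg Prod.snd (hinj hw)
  have hne : F.endpoint b ≠ F.endpoint !b :=
    F.endpoint_injective.ne (Bool.not_ne_self b).symm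
  obtain rfl := FamilyIndex.eq_of_ne_of_mem_ends hne (F.endpoint_mem_ends b)
    (F.endpoint_mem_ends _) (hb ▸ F'.endpoint_mem_ends c) (hnotb ▸ F'.endpoint_mem_ends _)
  exact F.parent_ne_child _ _ (hinj hv)

theorem isGenerationSet_generations (hx : x ∉ degenerateSet N) :
    IsGenerationSet (generations x) where
  as_parent := by
    rintro i hi _ ⟨z, rfl⟩
    obtain ⟨F, b, hF⟩ := FamilyIndex.exists_eq_parent (a := (i, z)) hi
    have hage : (i : ℕ) = F.1 := congrArg (fun a : Member N => (a.1 : ℕ)) hF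
    rw [hage]
    refine uniqueFamily_of_mem_points_quad hx (b := false) (c := false) ?_
    rw [hF]
    exact parent_mem_points_quad x F false b false
  as_child := by
    rintro i hi _ ⟨z, rfl⟩
    obtain ⟨F, c, hF⟩ := FamilyIndex.exists_eq_child (a := (i, z)) hi
    have hage : (i : ℕ) = F.1 + 1 := congrArg (fun a : Member N => (a.1 : ℕ)) hF
    rw [hage, Nat.add_sub_cancel]
    refine uniqueFamily_of_mem_points_quad hx (b := false) (c := false) ?_
    rw [hF]
    exact child_mem_points_quad x F false false c
  spouse_ne_sibling := by
    rintro i - - v - w _ hspouses hsiblings rfl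
    exact hspouses.not_areSiblings hx hsiblings

/-- The integer vector `e_p + e_q - e_r` of three points of the plane. -/
def tripleVec (p q r : ℂ) : ℂ →₀ ℤ :=
  Finsupp.single p 1 + Finsupp.single q 1 - Finsupp.single r 1

theorem tripleVec_apply {p q r : ℂ} (h : [p, q, r].Nodup) (v : ℂ) :
    tripleVec p q r v = if v = p ∨ v = q then 1 else if v = r then -1 else 0 := by
  simp only [tripleVec, Finsupp.add_apply, Finsupp.sub_apply, Finsupp.single_apply]
  grind

theorem support_tripleVec {p q r : ℂ} (h : [p, q, r].Nodup) :
    (tripleVec p q r).support = {p, q, r} := by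
  ext v
  simp only [Finsupp.mem_support_iff, tripleVec_apply h, Finset.mem_insert, Finset.mem_singleton]
  grind

theorem setOf_pos_tripleVec {p q r : ℂ} (h : [p, q, r].Nodup) :
    {v | 0 < tripleVec p q r v} = {p, q} := by
  ext v
  simp only [Set.mem_ofPred_eq, tripleVec_apply h, Set.mem_insert_iff, Set.mem_singleton_iff]
  grind

theorem card_support_tripleVec {p q r : ℂ} (h : [p, q, r].Nodup) :
    (tripleVec p q r).support.card = 3 := by
  rw [support_tripleVec h]
  simpa using List.toFinset_card_of_nodup h

theorem size_tripleVec {p q r : ℂ} (h : [p, q, r].Nodup) : size (tripleVec p q r) = 3 := by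
  have habs (v : ℂ) (hv : v ∈ (tripleVec p q r).support) : |tripleVec p q r v| = 1 := by
    rw [Finsupp.mem_support_iff, tripleVec_apply h] at hv
    rw [tripleVec_apply h]
    grind
  rw [size, Finsupp.sum, Finset.sum_congr rfl habs, Finset.sum_const, card_support_tripleVec h]
  norm_num

theorem IsFamily.isThreeOfFamily_tripleVec {G : Fin N → Set ℂ} {i : ℕ} {Q : Quad}
    (hQ : IsFamily G i Q) {p q r : ℂ} (hnodup : [p, q, r].Nodup)
    (hsub : ({p, q, r} : Set ℂ) ⊆ Q.points)
    (hpos : ({p, q} : Set ℂ) = {Q.p₁, Q.p₂} ∨ ({p, q} : Set ℂ) = {Q.c₁, Q.c₂}) :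
    IsThreeOfFamily G (tripleVec p q r) := by
  refine ⟨size_tripleVec hnodup, i, Q, hQ, ?_, card_support_tripleVec hnodup, ?_⟩
  · rw [support_tripleVec hnodup]
    push_cast
    exact hsub
  · rwa [setOf_pos_tripleVec hnodup]

theorem isThreeOfFamily_parents (hinj : Function.Injective (position x)) (F : FamilyIndex N)
    (b : Bool) : IsThreeOfFamily (generations x)
      (toPlane x (Pi.single (F.parent false) 1 + Pi.single (F.parent true) 1 -
        Pi.single (F.child b) 1)) := by
  simp only [map_add, map_sub, toPlane_single]
  refine (isFamily_quad hinj F false b).isThreeOfFamily_tripleVec ?_ ?_ (.inl rfl)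
  · simp [hinj.eq_iff, FamilyIndex.parent_inj, FamilyIndex.parent_ne_child]
  · simp [Set.insert_subset_iff, parent_mem_points_quad, child_mem_points_quad]

theorem isThreeOfFamily_children (hinj : Function.Injective (position x)) (F : FamilyIndex N)
    (b : Bool) : IsThreeOfFamily (generations x)
      (toPlane x (Pi.single (F.child false) 1 + Pi.single (F.child true) 1 -
        Pi.single (F.parent b) 1)) := by
  simp only [map_add, map_sub, toPlane_single]
  refine (isFamily_quad hinj F b false).isThreeOfFamily_tripleVec ?_ ?_ (.inr rfl)
  · simp [hinj.eq_iff, FamilyIndex.child_inj, (FamilyIndex.parent_ne_child _ _ _).symm]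
  · simp [Set.insert_subset_iff, parent_mem_points_quad, child_mem_points_quad]

theorem isFamilyVector_toPlane (hinj : Function.Injective (position x)) {F : FamilyIndex N}
    {l : Member N → ℤ} (h : l = F.vec ∨ l = -F.vec) :
    IsFamilyVector (generations x) (toPlane x l) := by
  refine ⟨F.1, quad x F false false, isFamily_quad hinj F false false, ?_⟩
  rw [← toPlane_vec, ← map_neg]
  exact h.imp (congrArg _) (congrArg _)

theorem isResonant_toPlane_familySum (hinj : Function.Injective (position x))
    {n : FamilyIndex N → ℤ} (h : absSum (familySum n) ≤ 6) :
    IsResonant (generations x) (toPlane x (familySum n)) where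
  support_subset := support_toPlane_subset _
  mass_eq := by rw [mass_toPlane hinj, sum_familySum]
  size_le := by rwa [size_toPlane hinj]
  momentum_eq := by rw [momentum_toPlane hinj, momentumAt_familySum]
  energy_eq := by exact_mod_cast (energy_toPlane hinj _).trans (energyAt_familySum x n)

theorem isCF_toPlane (hinj : Function.Injective (position x)) {F F' : FamilyIndex N}
    (hne : F ≠ F') {l : Member N → ℤ} (h6 : absSum l ≤ 6)
    (h : l = F.vec + F'.vec ∨ l = -(F.vec + F'.vec)) :
    IsCF (generations x) (toPlane x l) := by
  have hsum : F.vec + F'.vec = familySum (Pi.single F 1 + Pi.single F' 1) := by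
    rw [familySum_add, familySum_single, familySum_single]
  refine ⟨?_, F.1, F'.1, quad x F false false, quad x F' false false, isFamily_quad hinj _ _ _,
    isFamily_quad hinj _ _ _, fun hperm => hne (eq_of_trivialPerm_quad hinj hperm), ?_⟩
  · rw [hsum, ← familySum_neg] at h
    rcases h with rfl | rfl <;> exact isResonant_toPlane_familySum hinj h6
  · rw [← toPlane_vec, ← toPlane_vec, ← map_add, ← map_neg]
    exact h.imp (congrArg _) (congrArg _)

theorem isNonDegenerate_generations (hx : x ∉ degenerateSet N) :
    IsNonDegenerate (generations x) := by
  have hinj := position_injective hx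
  intro l hl hmass hsize hdefect
  obtain ⟨m, rfl⟩ := exists_toPlane_eq hinj hl
  rw [mass_toPlane hinj] at hmass
  rw [size_toPlane hinj] at hsize ⊢
  have hform := unitForm_of_notMem hx hmass hsize (by rw [defect_eq hinj, hdefect]; rfl)
  rcases hform with ⟨u, rfl⟩ | ⟨F, b, rfl⟩ | ⟨F, b, rfl⟩ | ⟨u, F, hfive, h⟩ |
    ⟨u, F, F', hne, hfive, hsix, h⟩
  · exact .inl (by rw [absSum_single, abs_one])
  · exact .inr (.inl (isThreeOfFamily_parents hinj F b))
  · exact .inr (.inl (isThreeOfFamily_children hinj F b))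
  · have hvec : m - Pi.single u 1 = F.vec ∨ m - Pi.single u 1 = -F.vec :=
      h.imp sub_eq_of_eq_add sub_eq_of_eq_add
    refine .inr (.inr (.inl ⟨by omega, _, isFamilyVector_toPlane hinj hvec, position x u,
      position_mem_allPoints x u, ?_⟩))
    rw [← toPlane_single, ← map_add, sub_add_cancel]
  · refine .inr (.inr (.inr ⟨by omega, position x u, position_mem_allPoints x u, ?_⟩))
    rw [← toPlane_single, ← map_sub]
    exact isCF_toPlane hinj hne hsix h

theorem isFamilyVector_or_isCF (hx : x ∉ degenerateSet N) {l : ℂ →₀ ℤ}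
    (hl : IsResonant (generations x) l) (h0 : l ≠ 0) :
    IsFamilyVector (generations x) l ∨ IsCF (generations x) l := by
  have hinj := position_injective hx
  obtain ⟨m, rfl⟩ := exists_toPlane_eq hinj hl.support_subset
  have h6 : absSum m ≤ 6 := size_toPlane hinj m ▸ hl.size_le
  have henergy : energyAt x m = 0 := by
    rw [← energy_toPlane hinj, hl.energy_eq, Complex.ofReal_zero]
  obtain ⟨n, rfl⟩ := eq_familySum_of_resonant hx (mass_toPlane hinj m ▸ hl.mass_eq) h6
    (momentum_toPlane hinj m ▸ hl.momentum_eq) henergy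
  rcases familySum_eq_of_absSum_le_six h6 with h | ⟨F, h⟩ | ⟨-, F, F', hne, h⟩
  · exact absurd (by rw [h, map_zero]) h0
  · exact .inl (isFamilyVector_toPlane hinj h)
  · exact .inr (isCF_toPlane hinj hne h6 h)

end Generic

end GenSet

end

theorem mainTheorem4 (N : ℕ) (hN : 1 ≤ N) :
    ∃ D : Set (GenSet.Params N), IsClosed D ∧ MeasureTheory.volume D = 0 ∧
      ∀ x : GenSet.Params N, x ∉ D →
        Function.Injective (GenSet.position x) ∧
        GenSet.IsGenerationSet (GenSet.generations x) ∧
        GenSet.IsNonDegenerate (GenSet.generations x) ∧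
        ∀ l : ℂ →₀ ℤ, GenSet.IsResonant (GenSet.generations x) l → l ≠ 0 →
          GenSet.IsFamilyVector (GenSet.generations x) l ∨
          GenSet.IsCF (GenSet.generations x) l :=
  ⟨GenSet.degenerateSet N, GenSet.isClosed_degenerateSet, GenSet.volume_degenerateSet,
    fun _ hx => ⟨GenSet.position_injective hx, GenSet.isGenerationSet_generations hx,
      GenSet.isNonDegenerate_generations hx,
      fun _ hl h0 => GenSet.isFamilyVector_or_isCF hx hl h0⟩⟩
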